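/- **Theorem 4.5.** Let $k\ge 2$ be an even integer. Let $B_k(X)$ be the $k$-th Bernoulli polynomial, $B_k$ the $k$-th Bernoulli number, and $\overline B_k(x)=B_k(x-\lfloor x\rfloor)$ for $x\in\mathbb R$. Put $\kappa(x)=1/s^2$ if $x=r/s$ with coprime integers $r,s$, $s>0$, and $\kappa(x)=0$ if $x$ is irrational. For integers $D\ge 0$ let $$P^*_{k,D}(x)=\sum_{\substack{(a,b,c)\in\mathbb Z^3,\ b^2-4ac=D\\ a>0>c}}(ax^2+bx+c)^{k-1},\qquad F^*_{k,D}(x)=\sum_{\substack{(a,b,c)\in\mathbb Z^3,\ b^2-4ac=D\\ ax^2+bx+c>0>a}}(ax^2+bx+c)^{k-1}.$$ Set $P_{k,D}=P^*_{k,D}$ and $F_{k,D}=F^*_{k,D}$ if $D$ is not a square; for $D=m^2$ with an integer $m>0$ set $$P_{k,m^2}(x)=P^*_{k,m^2}(x)+\tfrac1k\bigl(B_k(mx)-x^{2k-2}B_k(m/x)\bigr),\qquad F_{k,m^2}(x)=F^*_{k,m^2}(x)-\tfrac1k\overline B_k(mx)+\delta_{k,2}\,\tfrac{m^2\kappa(x)}2,$$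 where $x^{2k-2}B_k(m/x)$ is read as a polynomial in $x$ (also at $x=0$); and set $$P_{k,0}(x)=(1-x^{2k-2})\tfrac{B_k}{2k},\qquad F_{k,0}(x)=-\tfrac{B_k}{2k}.$$ For $\tau$ in the upper half plane and $q=e^{2\pi i\tau}$ let $S_x(\tau)=\sum_{D\ge0}P_{k,D}(x)\,q^D$ and $T_x(\tau)=\sum_{D\ge0}F_{k,D}(x)\,q^D$. 1. For every $x\in\mathbb R$, the series $S_x(\tau)$ converges absolutely for every $\tau$, and $S_x$ is a modular form of weight $k+\frac12$ on $\Gamma_0(4)$. 2. For every $x\in\mathbb Q$, the series $T_x(\tau)$ converges absolutely for every $\tau$, and $T_x$ is a modular form of weight $k+\frac12$ on $\Gamma_0(4)$. Here a modular form of weight $k+\frac12$ on $\Gamma_0(4)$ is a holomorphic function $f$ on the upper half plane such that $f(\gamma\tau)=\bigl(\theta(\gamma\tau)/\theta(\tau)\bigr)^{2k+1}f(\tau)$ for all $\gamma\in\Gamma_0(4)$, where $\theta(\tau)=\sum_{n\in\mathbb Z}e^{2\pi i n^2\tau}$, and such that $f$ is holomorphic at all cusps: for every $\gamma=\begin{pmatrix}\alpha&\beta\\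 \gamma'&\delta\end{pmatrix}\in\mathrm{SL}_2(\mathbb Z)$ the function $(\gamma'\tau+\delta)^{-(k+1/2)}f(\gamma\tau)$ is bounded as $\operatorname{Im}\tau\to\infty$. -/

import Mathlib

open scoped MatrixGroups Manifold

noncomputable section

namespace ZagierSeries

/-! ### Modular forms of weight `k + 1/2` on `Γ₀(4)` -/

/-- The unary theta function `θ(τ) = ∑_{n ∈ ℤ} e^{2πi n² τ}`. -/
def theta (τ : UpperHalfPlane) : ℂ :=
  ∑' n : ℤ, Complex.exp (2 * Real.pi * Complex.I * (n : ℂ) ^ 2 * (τ : ℂ))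

/-- Shimura's automorphic factor `j(γ, τ) = θ(γτ) / θ(τ)`, of weight `1/2`. It is used for
`γ ∈ Γ₀(4)`; note that `θ` has no zero in the upper half plane. -/
def autFactor (γ : SL(2, ℤ)) (τ : UpperHalfPlane) : ℂ := theta (γ • τ) / theta τ

/-- `f` is a (holomorphic) modular form of weight `k + 1/2` on `Γ₀(4)`: it is holomorphic on the
upper half plane, it transforms under `Γ₀(4)` with the factor `j(γ, τ) ^ (2k+1)`, and it is
holomorphic at every cusp. The last condition says that for every `γ = (a, b; c, d)` in `SL₂(ℤ)`
the function `(cτ + d)^{-(k + 1/2)} f(γτ)` stays bounded as `Im τ → ∞`; the choice of the branch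
of the square root does not matter, because it does not affect absolute values. -/
structure IsModularFormHalf (k : ℕ) (f : UpperHalfPlane → ℂ) : Prop where
  holo : MDifferentiable 𝓘(ℂ) 𝓘(ℂ) f
  transform : ∀ γ ∈ CongruenceSubgroup.Gamma0 4, ∀ τ : UpperHalfPlane,
    f (γ • τ) = autFactor γ τ ^ (2 * k + 1) * f τ
  bdd_at_cusps : ∀ γ : SL(2, ℤ), UpperHalfPlane.IsBoundedAtImInfty fun τ : UpperHalfPlane =>
    (((γ 1 0 : ℤ) : ℂ) * (τ : ℂ) + ((γ 1 1 : ℤ) : ℂ)) ^ (-((k : ℂ) + 1 / 2)) * f (γ • τ)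

/-! ### The polynomials `P_{k,D}` -/

/-- The triples `(a, b, c)` of integers with `b² - 4ac = D` and `a > 0 > c`. -/
def indefTriples (D : ℕ) : Set (ℤ × ℤ × ℤ) :=
  {p | p.2.1 ^ 2 - 4 * p.1 * p.2.2 = (D : ℤ) ∧ 0 < p.1 ∧ p.2.2 < 0}

theorem indefTriples_finite (D : ℕ) : (indefTriples D).Finite := by
  refine (((Set.finite_Icc (-(D : ℤ)) D)).prod
    ((Set.finite_Icc (-(D : ℤ)) D).prod (Set.finite_Icc (-(D : ℤ)) D))).subset ?_
  rintro ⟨a, b, c⟩ ⟨h, ha, hc⟩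
  simp only at h ha hc
  simp only [Set.mem_prod, Set.mem_Icc]
  refine ⟨⟨?_, ?_⟩, ⟨?_, ?_⟩, ?_, ?_⟩ <;>
    nlinarith [mul_pos ha (neg_pos.mpr hc), sq_nonneg b, sq_nonneg (b - 1), sq_nonneg (b + 1),
      mul_nonneg (Int.sub_nonneg.mpr (Int.add_one_le_iff.mpr ha))
        (Int.sub_nonneg.mpr (Int.add_one_le_iff.mpr hc))]

open Polynomial in
/-- `∑ (aX² + bX + c)^{k-1}` over all integers `a > 0 > c` and `b` with `b² - 4ac = D`. -/
def Pstar (k D : ℕ) : ℚ[X] :=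
  ∑ p ∈ (indefTriples_finite D).toFinset,
    (C (p.1 : ℚ) * X ^ 2 + C (p.2.1 : ℚ) * X + C (p.2.2 : ℚ)) ^ (k - 1)

open Polynomial in
/-- For `k ≥ 2`, the polynomial in `X` that is equal to `X^{2k-2} B_k(m/X)`, where `B_k` is the
`k`-th Bernoulli polynomial. -/
def bernoulliInv (k m : ℕ) : ℚ[X] :=
  ∑ j ∈ Finset.range (k + 1),
    C ((Polynomial.bernoulli k).coeff j * (m : ℚ) ^ j) * X ^ (2 * k - 2 - j)

theorem aeval_bernoulliInv {k : ℕ} (hk : 2 ≤ k) (m : ℕ) {x : ℝ} (hx : x ≠ 0) :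
    Polynomial.aeval x (bernoulliInv k m) =
      x ^ (2 * k - 2) * Polynomial.aeval ((m : ℝ) / x) (Polynomial.bernoulli k) := by
  have hdeg : (Polynomial.bernoulli k).natDegree < k + 1 := by
    refine Nat.lt_succ_of_le ?_
    rw [Polynomial.bernoulli]
    refine Polynomial.natDegree_sum_le_of_forall_le _ _ fun i hi => ?_
    refine (Polynomial.natDegree_monomial_le _).trans ?_
    omega
  rw [Polynomial.aeval_eq_sum_range' hdeg, bernoulliInv, map_sum, Finset.mul_sum]
  refine Finset.sum_congr rfl fun j hj => ?_
  have hj' : j ≤ 2 * k - 2 := by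
    have := Finset.mem_range.mp hj
    omega
  have e : x ^ (2 * k - 2) = x ^ (2 * k - 2 - j) * x ^ j := by
    rw [← pow_add, Nat.sub_add_cancel hj']
  simp only [map_mul, map_pow, Polynomial.aeval_X, Polynomial.aeval_C, eq_ratCast,
    Rat.cast_natCast, Algebra.smul_def, e, div_pow]
  field_simp

open Polynomial in
/-- The polynomial `P_{k,D}` for a discriminant `D ≥ 0`:
* `P_{k,0} = (1 - X^{2k-2}) B_k / (2k)`, with `B_k` the `k`-th Bernoulli number;
* if `D = m²` with `m > 0`, it is the sum `Pstar k D` plus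
  `(1/k) (B_k(mX) - X^{2k-2} B_k(m/X))`, with `B_k` the `k`-th Bernoulli polynomial;
* if `D` is not a square, it is the sum `Pstar k D`. -/
def P (k D : ℕ) : ℚ[X] :=
  if D = 0 then (1 - X ^ (2 * k - 2)) * C (_root_.bernoulli k / (2 * k))
  else if IsSquare D then
    Pstar k D + C (1 / (k : ℚ)) *
      ((Polynomial.bernoulli k).comp (C (Nat.sqrt D : ℚ) * X) - bernoulliInv k (Nat.sqrt D))
  else Pstar k D

/-! ### The functions `F_{k,D}` -/

/-- The periodic Bernoulli function `x ↦ B_k(x - ⌊x⌋)`. -/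
def bernoulliBar (k : ℕ) (x : ℝ) : ℝ :=
  Polynomial.aeval (x - (⌊x⌋ : ℝ)) (Polynomial.bernoulli k)

open Classical in
/-- `κ(x) = 1/s²` if `x = r/s` is rational in lowest terms with `s > 0`, and `κ(x) = 0` if `x` is
irrational. -/
def kappa (x : ℝ) : ℝ :=
  if h : ∃ r : ℚ, (r : ℝ) = x then 1 / (h.choose.den : ℝ) ^ 2 else 0

/-- The triples `(a, b, c)` of integers with `b² - 4ac = D` and `ax² + bx + c > 0 > a`. -/
def coneTriples (D : ℕ) (x : ℝ) : Set (ℤ × ℤ × ℤ) :=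
  {p | p.2.1 ^ 2 - 4 * p.1 * p.2.2 = (D : ℤ) ∧
    0 < (p.1 : ℝ) * x ^ 2 + (p.2.1 : ℝ) * x + (p.2.2 : ℝ) ∧ p.1 < 0}

/-- `∑ (ax² + bx + c)^{k-1}` over all integers `a, b, c` with `b² - 4ac = D` and
`ax² + bx + c > 0 > a`. For rational `x` the sum is finite. -/
def Fstar (k D : ℕ) (x : ℝ) : ℝ :=
  ∑' p : coneTriples D x,
    ((p.1.1 : ℝ) * x ^ 2 + (p.1.2.1 : ℝ) * x + (p.1.2.2 : ℝ)) ^ (k - 1)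

/-- The function `F_{k,D}` for a discriminant `D ≥ 0`:
* `F_{k,0}(x) = - B_k / (2k)`, with `B_k` the `k`-th Bernoulli number;
* if `D = m²` with `m > 0`, it is the sum `Fstar k D x` minus `(1/k) B_k(mx - ⌊mx⌋)`, with `B_k`
  the `k`-th Bernoulli polynomial, plus `m² κ(x) / 2` if `k = 2`;
* if `D` is not a square, it is the sum `Fstar k D x`. -/
def F (k D : ℕ) (x : ℝ) : ℝ :=
  if D = 0 then -(_root_.bernoulli k : ℝ) / (2 * k)
  else if IsSquare D then
    Fstar k D x - 1 / (k : ℝ) * bernoulliBar k ((Nat.sqrt D : ℝ) * x)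
      + (if k = 2 then (Nat.sqrt D : ℝ) ^ 2 * kappa x / 2 else 0)
  else Fstar k D x

/-! ### The generating functions -/

/-- `q^D = e^{2πiDτ}`. -/
def qPow (D : ℕ) (τ : UpperHalfPlane) : ℂ :=
  Complex.exp (2 * Real.pi * Complex.I * (D : ℂ) * (τ : ℂ))

/-- The `D`-th term `P_{k,D}(x) q^D`. -/
def STerm (k : ℕ) (x : ℝ) (τ : UpperHalfPlane) (D : ℕ) : ℂ :=
  ((Polynomial.aeval x (P k D) : ℝ) : ℂ) * qPow D τ

/-- The `D`-th term `F_{k,D}(x) q^D`. -/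
def TTerm (k : ℕ) (x : ℝ) (τ : UpperHalfPlane) (D : ℕ) : ℂ :=
  ((F k D x : ℝ) : ℂ) * qPow D τ

/-- `S_x(τ) = ∑_{D ≥ 0} P_{k,D}(x) q^D`. -/
def S (k : ℕ) (x : ℝ) (τ : UpperHalfPlane) : ℂ := ∑' D : ℕ, STerm k x τ D

/-- `T_x(τ) = ∑_{D ≥ 0} F_{k,D}(x) q^D`. -/
def T (k : ℕ) (x : ℝ) (τ : UpperHalfPlane) : ℂ := ∑' D : ℕ, TTerm k x τ D

end ZagierSeries

end

noncomputable section

namespace ZagierSeries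

open Complex

/-! ### Power series in `q = e^{2πiz}` with polynomially bounded coefficients -/

/-! Both halves reduce to one criterion, `ModularCoeff`. A q-series f with polynomially bounded
coefficients is a modular form of weight k + 1/2 on Γ₀(4) as soon as (-2iz)^{-1/2} z^{-k} f(-1/(4z))
has period 1. To see this, divide by θ^{2k+1}, which is allowed because θ has no zeros
(`theta_ne_zero`). The quotient is invariant under z ↦ z + 1 and under z ↦ z/(4z+1), the latter
being a unit translation conjugated by z ↦ -1/(4z); together with -1 these maps generate Γ₀(4)
(`Gamma0_four_le_closure`). Polynomial coefficients give moderate growth near the real line, and for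
a periodic holomorphic function moderate growth at a cusp improves to boundedness. The criterion is
stable under linear combinations, so only suitable building blocks are needed.

For S_x the blocks are the Rankin–Cohen brackets of θ(z) with G_{k-2ν}(4z), 0 ≤ ν < k/2, where G_w
is the Eisenstein series with constant term -B_w/(2w). They satisfy the criterion because the
suitably normalised derivatives of θ and G_w transform with the same exponential factor
(`derivatives_transform`), which cancels in the alternating sum (`bracket_transform`). For w = 2 the
anomaly of G_2 is absorbed by one further derivative of θ. Writing D = b² + 4n and splitting n =
a·(-c) turns the coefficients of the brackets into sums over forms with a > 0 > c, the constant term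
of G_w supplying the Bernoulli numbers. Expanding (ax² + bx + c)^{k-1} and using the symmetries b ↦
-b and (a, c) ↦ (-c, -a) then shows that P_{k,D}(x) is a combination of these coefficients with
weights x^{2k-2-2ν} - x^{2ν} independent of D (`aeval_P_eq`).

For T_x, as a function of x, F_{k,D} has period 1 on ℚ, satisfies F(x) = x^{2k-2} F(1/x) - P(x) for
rational x > 0 (`F_inv`), and F(0) = -P(0) (`F_zero`). The Euclidean algorithm on x therefore writes
T_x as a finite combination of series S_y. -/

/-- The coefficients `c n` grow at most polynomially. -/
def PolyBdd (c : ℕ → ℝ) : Prop := ∃ (C : ℝ) (N : ℕ), ∀ n, |c n| ≤ C * ((n : ℝ) + 1) ^ N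

/-- The term `c n e^{2πinz}`. -/
def qTerm (c : ℕ → ℝ) (z : ℂ) (n : ℕ) : ℂ :=
  (c n : ℂ) * exp (2 * Real.pi * I * (n : ℂ) * z)

/-- The sum `∑ c n e^{2πinz}`. -/
def qSeries (c : ℕ → ℝ) (z : ℂ) : ℂ := ∑' n, qTerm c z n

theorem PolyBdd.add {c d : ℕ → ℝ} (hc : PolyBdd c) (hd : PolyBdd d) :
    PolyBdd fun n => c n + d n := by
  obtain ⟨C, N, h⟩ := hc
  obtain ⟨C', N', h'⟩ := hd
  have hC : 0 ≤ C := by simpa using (abs_nonneg _).trans (h 0)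
  have hC' : 0 ≤ C' := by simpa using (abs_nonneg _).trans (h' 0)
  refine ⟨C + C', N + N', fun n => (abs_add_le _ _).trans ?_⟩
  have h1 : (1 : ℝ) ≤ (n : ℝ) + 1 := by linarith [n.cast_nonneg (α := ℝ)]
  rw [add_mul]
  refine add_le_add ((h n).trans ?_) ((h' n).trans ?_)
  · exact mul_le_mul_of_nonneg_left (pow_le_pow_right₀ h1 (by omega)) hC
  · exact mul_le_mul_of_nonneg_left (pow_le_pow_right₀ h1 (by omega)) hC'

theorem PolyBdd.mul {c d : ℕ → ℝ} (hc : PolyBdd c) (hd : PolyBdd d) :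
    PolyBdd fun n => c n * d n := by
  obtain ⟨C, N, h⟩ := hc
  obtain ⟨C', N', h'⟩ := hd
  refine ⟨C * C', N + N', fun n => ?_⟩
  rw [abs_mul, pow_add, mul_mul_mul_comm]
  exact mul_le_mul (h n) (h' n) (abs_nonneg _) ((abs_nonneg _).trans (h n))

theorem PolyBdd.const (a : ℝ) : PolyBdd fun _ => a := ⟨|a|, 0, fun n => by simp⟩

theorem PolyBdd.natCast : PolyBdd fun n => (n : ℝ) :=
  ⟨1, 1, fun n => by rw [abs_of_nonneg n.cast_nonneg]; linarith⟩

theorem PolyBdd.smul {c : ℕ → ℝ} (hc : PolyBdd c) (a : ℝ) : PolyBdd fun n => a * c n :=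
  (PolyBdd.const a).mul hc

theorem PolyBdd.natCast_pow (j : ℕ) : PolyBdd fun n => (n : ℝ) ^ j := by
  induction j with
  | zero => simpa using PolyBdd.const 1
  | succ j ih => simpa only [pow_succ] using ih.mul PolyBdd.natCast

theorem PolyBdd.sum {ι : Type*} (s : Finset ι) {c : ι → ℕ → ℝ} (h : ∀ i ∈ s, PolyBdd (c i)) :
    PolyBdd fun n => ∑ i ∈ s, c i n := by
  classical
  induction s using Finset.induction_on with
  | empty => simpa using PolyBdd.const 0
  | insert a s ha ih =>
    simp only [Finset.sum_insert ha]
    exact (h a (by simp)).add (ih fun i hi => h i (by simp [hi]))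

/-- The Cauchy product of two sequences. -/
def cauchyProd (c d : ℕ → ℝ) (n : ℕ) : ℝ := ∑ p ∈ Finset.HasAntidiagonal.antidiagonal n, c p.1 * d p.2

theorem PolyBdd.cauchyProd {c d : ℕ → ℝ} (hc : PolyBdd c) (hd : PolyBdd d) :
    PolyBdd (cauchyProd c d) := by
  obtain ⟨C, N, h⟩ := hc
  obtain ⟨C', N', h'⟩ := hd
  have hC : 0 ≤ C := by simpa using (abs_nonneg _).trans (h 0)
  have hC' : 0 ≤ C' := by simpa using (abs_nonneg _).trans (h' 0)
  refine ⟨C * C', N + N' + 1, fun n => ?_⟩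
  refine (Finset.abs_sum_le_sum_abs _ _).trans ?_
  calc ∑ p ∈ Finset.HasAntidiagonal.antidiagonal n, |c p.1 * d p.2|
      ≤ ∑ p ∈ Finset.HasAntidiagonal.antidiagonal n, C * C' * ((n : ℝ) + 1) ^ (N + N') := by
        refine Finset.sum_le_sum fun p hp => ?_
        have hp' := Finset.HasAntidiagonal.mem_antidiagonal.mp hp
        have h1 : (p.1 : ℝ) ≤ n := by exact_mod_cast (by omega : p.1 ≤ n)
        have h2 : (p.2 : ℝ) ≤ n := by exact_mod_cast (by omega : p.2 ≤ n)
        rw [abs_mul, pow_add, mul_mul_mul_comm]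
        refine mul_le_mul ((h _).trans ?_) ((h' _).trans ?_) (abs_nonneg _) (by positivity)
        · gcongr
        · gcongr
    _ = C * C' * ((n : ℝ) + 1) ^ (N + N' + 1) := by
        simp only [Finset.sum_const, Finset.Nat.card_antidiagonal, nsmul_eq_mul]
        push_cast
        ring

theorem PolyBdd.of_abs_le {c d : ℕ → ℝ} (hd : PolyBdd d) (h : ∀ n, |c n| ≤ d n) : PolyBdd c := by
  obtain ⟨C, N, h'⟩ := hd
  exact ⟨C, N, fun n => (h n).trans ((le_abs_self _).trans (h' n))⟩

theorem PolyBdd.congr {c d : ℕ → ℝ} (hd : PolyBdd d) (h : ∀ n, c n = d n) : PolyBdd c := by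
  rwa [show c = d from funext h]

/-! ### Convergence, growth and termwise differentiation of q-series -/

theorem norm_qTerm (c : ℕ → ℝ) (z : ℂ) (n : ℕ) :
    ‖qTerm c z n‖ = |c n| * Real.exp (-2 * Real.pi * z.im) ^ n := by
  rw [qTerm, norm_mul, norm_exp, ← Real.exp_nat_mul, Complex.norm_real, Real.norm_eq_abs]
  congr 2
  have : (2 * Real.pi * I * (n : ℂ) * z) = ((2 * Real.pi * n : ℝ) : ℂ) * (I * z) := by
    push_cast; ring
  rw [this, re_ofReal_mul]
  simp
  ring

/-- Binomial coefficients are preferred to powers because ∑ C(n+N, N) rⁿ has the closed form (1 -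
r)^{-(N+1)}. -/
theorem pow_succ_le_factorial_mul_choose (n N : ℕ) :
    ((n : ℝ) + 1) ^ N ≤ (N.factorial : ℝ) * ((n + N).choose N : ℝ) := by
  have h := Nat.pow_succ_le_ascFactorial (n + 1) N
  rw [Nat.ascFactorial_eq_factorial_mul_choose] at h
  exact_mod_cast h

theorem exp_lt_one_of_im_pos {z : ℂ} (hz : 0 < z.im) : Real.exp (-2 * Real.pi * z.im) < 1 := by
  rw [Real.exp_lt_one_iff]
  have := mul_pos Real.pi_pos hz
  linarith

theorem summable_pow_mul_geometric_exp (N : ℕ) {z : ℂ} (hz : 0 < z.im) :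
    Summable fun n : ℕ => ((n : ℝ) + 1) ^ N * Real.exp (-2 * Real.pi * z.im) ^ n := by
  have hr : ‖Real.exp (-2 * Real.pi * z.im)‖ < 1 := by
    rw [Real.norm_eq_abs, abs_of_pos (Real.exp_pos _)]; exact exp_lt_one_of_im_pos hz
  refine Summable.of_nonneg_of_le (fun n => by positivity) (fun n => ?_)
    ((summable_choose_mul_geometric_of_norm_lt_one N hr).mul_left (N.factorial : ℝ))
  rw [← mul_assoc]
  exact mul_le_mul_of_nonneg_right (pow_succ_le_factorial_mul_choose n N) (by positivity)

theorem PolyBdd.summable_norm {c : ℕ → ℝ} (hc : PolyBdd c) {z : ℂ} (hz : 0 < z.im) :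
    Summable fun n => ‖qTerm c z n‖ := by
  obtain ⟨C, N, h⟩ := hc
  refine Summable.of_nonneg_of_le (fun n => norm_nonneg _) (fun n => ?_)
    ((summable_pow_mul_geometric_exp N hz).mul_left C)
  rw [norm_qTerm, ← mul_assoc]
  exact mul_le_mul_of_nonneg_right (h n) (by positivity)

theorem PolyBdd.summable {c : ℕ → ℝ} (hc : PolyBdd c) {z : ℂ} (hz : 0 < z.im) :
    Summable (qTerm c z) := (hc.summable_norm hz).of_norm

/-- A power series in `q` with polynomially bounded coefficients grows moderately at the real
line. -/
theorem PolyBdd.norm_qSeries_le {c : ℕ → ℝ} (hc : PolyBdd c) :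
    ∃ (C : ℝ) (M : ℕ), 0 ≤ C ∧ ∀ z : ℂ, 0 < z.im → ‖qSeries c z‖ ≤ C * (1 + 1 / z.im) ^ M := by
  obtain ⟨C, N, h⟩ := id hc
  have hC : 0 ≤ C := by simpa using (abs_nonneg _).trans (h 0)
  refine ⟨C * N.factorial, N + 1, by positivity, fun z hz => ?_⟩
  set r := Real.exp (-2 * Real.pi * z.im) with hr
  have hr1 : r < 1 := exp_lt_one_of_im_pos hz
  have hrn : ‖r‖ < 1 := by
    rw [Real.norm_eq_abs, abs_of_pos (Real.exp_pos _)]; exact hr1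
  have hs := (summable_choose_mul_geometric_of_norm_lt_one N hrn)
  calc ‖qSeries c z‖ ≤ ∑' n, ‖qTerm c z n‖ := norm_tsum_le_tsum_norm (hc.summable_norm hz)
    _ ≤ ∑' n : ℕ, C * N.factorial * (((n + N).choose N : ℝ) * r ^ n) := by
        refine (hc.summable_norm hz).tsum_le_tsum (fun n => ?_) (hs.mul_left _)
        rw [norm_qTerm, ← mul_assoc]
        refine mul_le_mul_of_nonneg_right ((h n).trans ?_) (by positivity)
        rw [mul_assoc]
        exact mul_le_mul_of_nonneg_left (pow_succ_le_factorial_mul_choose n N) hC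
    _ = C * N.factorial * (1 / (1 - r) ^ (N + 1)) := by
        rw [tsum_mul_left, tsum_choose_mul_geometric_of_norm_lt_one N hrn]
    -- With y = Im z, the bound 1/(1 - r) ≤ 1 + 1/y amounts to r(1 + y) ≤ 1, which follows from
    -- e^{2πy} ≥ 1 + 2πy.
    _ ≤ C * N.factorial * (1 + 1 / z.im) ^ (N + 1) := by
        refine mul_le_mul_of_nonneg_left ?_ (by positivity)
        rw [← one_div_pow]
        refine pow_le_pow_left₀ (by rw [one_div, inv_nonneg]; linarith) ?_ _
        have h1r : 0 < 1 - r := by linarith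
        have h2 : r * (1 + 2 * Real.pi * z.im) ≤ 1 := by
          have h3 := Real.add_one_le_exp (2 * Real.pi * z.im)
          calc r * (1 + 2 * Real.pi * z.im) ≤ r * Real.exp (2 * Real.pi * z.im) :=
                mul_le_mul_of_nonneg_left (by linarith) (Real.exp_pos _).le
            _ = 1 := by rw [hr, ← Real.exp_add]; simp
        have h4 : r * (1 + z.im) ≤ 1 := by
          refine le_trans (mul_le_mul_of_nonneg_left ?_ (Real.exp_pos _).le) h2
          nlinarith [Real.pi_gt_three]
        rw [div_le_iff₀ h1r]
        have : (1 + 1 / z.im) * (1 - r) = (1 + z.im - r * (1 + z.im)) / z.im := by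
          field_simp
          ring
        rw [this, le_div_iff₀ hz]
        linarith

/-- On the half-plane above height Im z / 2 the derived series is dominated by its absolute values
at that height, so it may be differentiated term by term. -/
theorem PolyBdd.hasDerivAt_qSeries {c : ℕ → ℝ} (hc : PolyBdd c) {z : ℂ} (hz : 0 < z.im) :
    HasDerivAt (qSeries c) (2 * Real.pi * I * qSeries (fun n => n * c n) z) z := by
  set w : ℂ := (z.im / 2 : ℝ) * I with hw
  have hwim : w.im = z.im / 2 := by simp [hw]
  have hd : PolyBdd fun n => (n : ℝ) * c n := PolyBdd.natCast.mul hc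
  have hu := (hd.summable_norm (z := w) (by rw [hwim]; linarith)).mul_left (2 * Real.pi)
  have hmem : z ∈ {s : ℂ | z.im / 2 < s.im} := by
    rw [Set.mem_ofPred_eq]; linarith
  have key := hasDerivAt_tsum_of_isPreconnected (t := {s : ℂ | z.im / 2 < s.im})
    (g := fun n s => qTerm c s n)
    (g' := fun n s => 2 * Real.pi * I * qTerm (fun n => (n : ℝ) * c n) s n) (y := z) (y₀ := z) hu
    (isOpen_lt continuous_const continuous_im)
    (convex_halfSpace_im_gt _).isPreconnected ?_ ?_ hmem (hc.summable hz) hmem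
  · rw [tsum_mul_left] at key
    exact key
  · intro n s _
    have h1 : HasDerivAt (fun s : ℂ => 2 * Real.pi * I * (n : ℂ) * s)
        (2 * Real.pi * I * (n : ℂ)) s := by
      simpa using (hasDerivAt_id s).const_mul (2 * Real.pi * I * (n : ℂ))
    have h2 := (h1.cexp).const_mul (c n : ℂ)
    have h3 : (c n : ℂ) * (exp (2 * Real.pi * I * (n : ℂ) * s) * (2 * Real.pi * I * (n : ℂ))) =
        2 * Real.pi * I * qTerm (fun n => (n : ℝ) * c n) s n := by
      simp only [qTerm]
      push_cast
      ring
    rw [h3] at h2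
    exact h2
  · intro n s hs
    have hs' : z.im / 2 < s.im := hs
    rw [norm_mul, norm_qTerm, norm_qTerm]
    have : ‖(2 * Real.pi * I : ℂ)‖ = 2 * Real.pi := by
      simp [abs_of_pos Real.pi_pos]
    rw [this, hwim]
    have hle : -2 * Real.pi * s.im ≤ -2 * Real.pi * (z.im / 2) := by nlinarith [Real.pi_pos]
    gcongr

theorem PolyBdd.differentiableAt_qSeries {c : ℕ → ℝ} (hc : PolyBdd c) {z : ℂ} (hz : 0 < z.im) :
    DifferentiableAt ℂ (qSeries c) z := (hc.hasDerivAt_qSeries hz).differentiableAt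

theorem qSeries_add_one (c : ℕ → ℝ) (z : ℂ) : qSeries c (z + 1) = qSeries c z := by
  refine tsum_congr fun n => ?_
  rw [qTerm, qTerm, mul_add, exp_add, mul_one,
    show (2 * Real.pi * I * (n : ℂ)) = n * (2 * Real.pi * I) by ring, exp_nat_mul_two_pi_mul_I,
    mul_one]

theorem qSeries_mul {c d : ℕ → ℝ} (hc : PolyBdd c) (hd : PolyBdd d) {z : ℂ} (hz : 0 < z.im) :
    qSeries c z * qSeries d z = qSeries (cauchyProd c d) z := by
  rw [qSeries, qSeries, tsum_mul_tsum_eq_tsum_sum_antidiagonal_of_summable_norm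
    (hc.summable_norm hz) (hd.summable_norm hz)]
  refine tsum_congr fun n => ?_
  rw [qTerm, cauchyProd, ofReal_sum, Finset.sum_mul]
  refine Finset.sum_congr rfl fun p hp => ?_
  rw [← Finset.HasAntidiagonal.mem_antidiagonal.mp hp, qTerm, qTerm]
  push_cast
  rw [mul_mul_mul_comm, ← exp_add]
  ring_nf

theorem qSeries_add {c d : ℕ → ℝ} (hc : PolyBdd c) (hd : PolyBdd d) {z : ℂ} (hz : 0 < z.im) :
    qSeries (fun n => c n + d n) z = qSeries c z + qSeries d z := by
  rw [qSeries, qSeries, qSeries, ← (hc.summable hz).tsum_add (hd.summable hz)]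
  refine tsum_congr fun n => ?_
  simp only [qTerm]
  push_cast
  ring

theorem qSeries_smul (a : ℝ) (c : ℕ → ℝ) (z : ℂ) :
    qSeries (fun n => a * c n) z = a * qSeries c z := by
  rw [qSeries, qSeries, ← tsum_mul_left]
  refine tsum_congr fun n => ?_
  simp only [qTerm]
  push_cast
  ring

theorem qSeries_zero (z : ℂ) : qSeries (fun _ => 0) z = 0 := by
  simp [qSeries, qTerm]

theorem qSeries_sum {ι : Type*} (s : Finset ι) {c : ι → ℕ → ℝ} (h : ∀ i ∈ s, PolyBdd (c i))
    {z : ℂ} (hz : 0 < z.im) :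
    qSeries (fun n => ∑ i ∈ s, c i n) z = ∑ i ∈ s, qSeries (c i) z := by
  classical
  induction s using Finset.induction_on with
  | empty => simpa using qSeries_zero z
  | insert a s ha ih =>
    simp only [Finset.sum_insert ha]
    rw [qSeries_add (h a (by simp)) (PolyBdd.sum s fun i hi => h i (by simp [hi])) hz,
      ih fun i hi => h i (by simp [hi])]

/-- The coefficients of the power series `∑ c n q^{4n}`. -/
def dilateFour (c : ℕ → ℝ) (n : ℕ) : ℝ := if 4 ∣ n then c (n / 4) else 0

theorem qSeries_dilateFour (c : ℕ → ℝ) (z : ℂ) :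
    qSeries (dilateFour c) z = qSeries c (4 * z) := by
  have hinj : Function.Injective fun n : ℕ => 4 * n := fun a b h => by
    simpa using h
  rw [qSeries, qSeries, ← hinj.tsum_eq]
  · refine tsum_congr fun n => ?_
    simp only [qTerm, dilateFour, dvd_mul_right, if_true, Nat.cast_mul, Nat.cast_ofNat]
    rw [Nat.mul_div_cancel_left n (by norm_num)]
    ring_nf
  · intro n hn
    by_contra h
    apply hn
    have : ¬ 4 ∣ n := fun ⟨m, hm⟩ => h ⟨m, hm.symm⟩
    simp [qTerm, dilateFour, this]

theorem PolyBdd.dilateFour {c : ℕ → ℝ} (hc : PolyBdd c) : PolyBdd (dilateFour c) := by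
  obtain ⟨C, N, h⟩ := hc
  have hC : 0 ≤ C := by simpa using (abs_nonneg _).trans (h 0)
  refine ⟨C, N, fun n => ?_⟩
  unfold ZagierSeries.dilateFour
  split_ifs with hn
  · refine (h _).trans ?_
    gcongr
    exact Nat.div_le_self n 4
  · simp only [abs_zero]
    positivity

/-! ### The theta function -/

/-- The number of integers `b` with `b² = n`. -/
def thetaCoeff (n : ℕ) : ℝ :=
  (((Finset.Icc (-(n : ℤ)) n).filter fun b => b ^ 2 = (n : ℤ)).card : ℝ)

theorem mem_filter_sq_eq (n : ℕ) (b : ℤ) :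
    b ∈ (Finset.Icc (-(n : ℤ)) n).filter (fun b => b ^ 2 = (n : ℤ)) ↔ b ^ 2 = (n : ℤ) := by
  simp only [Finset.mem_filter, Finset.mem_Icc, and_iff_right_iff_imp]
  intro h
  constructor <;> nlinarith [sq_nonneg (b - 1), sq_nonneg (b + 1)]

theorem thetaCoeff_zero : thetaCoeff 0 = 1 := by
  have : (Finset.Icc (-((0 : ℕ) : ℤ)) (0 : ℕ)).filter (fun b => b ^ 2 = ((0 : ℕ) : ℤ)) = {0} := by
    ext b
    rw [mem_filter_sq_eq]
    simp
  rw [thetaCoeff, this]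
  simp

theorem thetaCoeff_of_not_isSquare {n : ℕ} (hn : ¬ IsSquare n) : thetaCoeff n = 0 := by
  rw [thetaCoeff, Nat.cast_eq_zero, Finset.card_eq_zero, Finset.eq_empty_iff_forall_notMem]
  intro b hb
  rw [mem_filter_sq_eq] at hb
  refine hn ⟨b.natAbs, ?_⟩
  zify
  rw [← sq, sq_abs, hb]

theorem thetaCoeff_sq {m : ℕ} (hm : m ≠ 0) : thetaCoeff (m ^ 2) = 2 := by
  have : (Finset.Icc (-((m ^ 2 : ℕ) : ℤ)) (m ^ 2 : ℕ)).filter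
      (fun b => b ^ 2 = ((m ^ 2 : ℕ) : ℤ)) = {(m : ℤ), -(m : ℤ)} := by
    ext b
    rw [mem_filter_sq_eq]
    simp only [Nat.cast_pow, Finset.mem_insert, Finset.mem_singleton]
    exact sq_eq_sq_iff_eq_or_eq_neg
  rw [thetaCoeff, this, Finset.card_pair]
  · norm_num
  · intro h
    have : (m : ℤ) ≠ 0 := by exact_mod_cast hm
    omega

theorem polyBdd_thetaCoeff : PolyBdd thetaCoeff := by
  refine ⟨2, 1, fun n => ?_⟩
  rw [thetaCoeff, abs_of_nonneg (Nat.cast_nonneg _)]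
  refine le_trans (Nat.cast_le.mpr (Finset.card_filter_le _ _)) ?_
  rw [Int.card_Icc]
  have : ((n : ℤ) + 1 - -(n : ℤ)).toNat = 2 * n + 1 := by omega
  rw [this]
  push_cast
  linarith

theorem theta_eq_jacobiTheta (τ : UpperHalfPlane) : theta τ = jacobiTheta (2 * τ) :=
  tsum_congr fun n => by ring_nf

theorem jacobiTheta_two_mul_eq_qSeries {z : ℂ} (hz : 0 < z.im) :
    jacobiTheta (2 * z) = qSeries thetaCoeff z := by
  have him : 0 < (2 * z).im := by simpa using hz
  have hs := hasSum_jacobiTheta₂_term 0 him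
  rw [← jacobiTheta_eq_jacobiTheta₂] at hs
  have hf := hs.tsum_fiberwise (fun b : ℤ => b.natAbs ^ 2)
  rw [← hf.tsum_eq]
  refine tsum_congr fun n => ?_
  have hset : (fun b : ℤ => b.natAbs ^ 2) ⁻¹' {n} =
      ↑((Finset.Icc (-(n : ℤ)) n).filter fun b => b ^ 2 = (n : ℤ)) := by
    ext b
    rw [Finset.mem_coe, mem_filter_sq_eq, Set.mem_preimage, Set.mem_singleton_iff]
    zify
    rw [sq_abs]
  rw [hset, Finset.tsum_subtype' _ fun b : ℤ => jacobiTheta₂_term b 0 (2 * z)]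
  have : ∀ b ∈ (Finset.Icc (-(n : ℤ)) n).filter (fun b => b ^ 2 = (n : ℤ)),
      jacobiTheta₂_term b 0 (2 * z) = exp (2 * Real.pi * I * (n : ℂ) * z) := by
    intro b hb
    rw [mem_filter_sq_eq] at hb
    have hb' : (b : ℂ) ^ 2 = n := by exact_mod_cast hb
    rw [jacobiTheta₂_term, hb']
    ring_nf
  rw [Finset.sum_congr rfl this, Finset.sum_const, nsmul_eq_mul]
  rw [qTerm, thetaCoeff, ofReal_natCast]

theorem theta_eq_qSeries (τ : UpperHalfPlane) : theta τ = qSeries thetaCoeff τ := by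
  rw [theta_eq_jacobiTheta, jacobiTheta_two_mul_eq_qSeries τ.im_pos]

/-- The square root `(-2iz)^{1/2}`, the factor in the functional equation of `θ`. -/
def sqrtFactor (z : ℂ) : ℂ := (-2 * I * z) ^ (1 / 2 : ℂ)

theorem sqrtFactor_sq (z : ℂ) : sqrtFactor z ^ 2 = -2 * I * z := by
  rw [sqrtFactor, ← cpow_nat_mul]
  norm_num

theorem ne_zero_of_im_pos {z : ℂ} (hz : 0 < z.im) : z ≠ 0 := by
  rintro rfl
  simp at hz

theorem sqrtFactor_ne_zero {z : ℂ} (hz : 0 < z.im) : sqrtFactor z ≠ 0 := by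
  intro h
  have := sqrtFactor_sq z
  rw [h] at this
  simp [ne_zero_of_im_pos hz] at this

theorem hasDerivAt_sqrtFactor {z : ℂ} (hz : 0 < z.im) :
    HasDerivAt sqrtFactor ((1 / 2) / z * sqrtFactor z) z := by
  have hz0 := ne_zero_of_im_pos hz
  have h1 : HasDerivAt (fun s : ℂ => -2 * I * s) (-2 * I) z := by
    simpa using (hasDerivAt_id z).const_mul (-2 * I)
  have hne : -2 * I * z ≠ 0 := by simp [hz0]
  have h2 := h1.cpow_const (c := (1 / 2 : ℂ)) (Or.inl (by simpa using hz))
  have h3 : (1 / 2 : ℂ) * (-2 * I * z) ^ ((1 / 2 : ℂ) - 1) * (-2 * I) =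
      (1 / 2) / z * sqrtFactor z := by
    rw [cpow_sub _ _ hne, cpow_one, sqrtFactor]
    field_simp
  rw [h3] at h2
  exact h2

theorem im_neg_inv_four_mul_pos {z : ℂ} (hz : 0 < z.im) : 0 < (-1 / (4 * z)).im := by
  rw [neg_div, one_div, neg_im, inv_im]
  have h4 : 0 < (4 * z).im := by simpa using hz
  have : 0 < normSq (4 * z) := normSq_pos.mpr (ne_zero_of_im_pos h4)
  rw [neg_div, neg_neg]
  positivity

theorem qSeries_thetaCoeff_fricke {z : ℂ} (hz : 0 < z.im) :
    qSeries thetaCoeff (-1 / (4 * z)) = sqrtFactor z * qSeries thetaCoeff z := by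
  have hz0 := ne_zero_of_im_pos hz
  rw [← jacobiTheta_two_mul_eq_qSeries hz,
    ← jacobiTheta_two_mul_eq_qSeries (im_neg_inv_four_mul_pos hz), jacobiTheta_eq_jacobiTheta₂,
    jacobiTheta_eq_jacobiTheta₂, jacobiTheta₂_functional_equation 0 (2 * z)]
  have e1 : -I * (2 * z) = -2 * I * z := by ring
  have e2 : 2 * (-1 / (4 * z)) = -1 / (2 * z) := by field_simp; norm_num
  have h3 := sqrtFactor_ne_zero hz
  rw [e1, e2, ← sqrtFactor]
  simp
  field_simp

/-! ### The theta function has no zero -/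

/-- The product of the three even theta constants, up to an exponential factor. -/
def thetaProd (z : ℂ) : ℂ := jacobiTheta₂ 0 z * jacobiTheta₂ (1 / 2) z * jacobiTheta₂ (z / 2) z

theorem jacobiTheta₂_add_one_right (w z : ℂ) :
    jacobiTheta₂ w (z + 1) = jacobiTheta₂ (w + 1 / 2) z := by
  refine tsum_congr fun n => ?_
  rw [jacobiTheta₂_term, jacobiTheta₂_term]
  obtain ⟨m, hm⟩ : ∃ m : ℤ, n ^ 2 = n + 2 * m := by
    obtain ⟨r, hr⟩ := Int.even_mul_pred_self n
    exact ⟨r, by linarith⟩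
  have hm' : (n : ℂ) ^ 2 = n + 2 * m := by exact_mod_cast hm
  refine exp_eq_exp_iff_exists_int.mpr ⟨m, ?_⟩
  linear_combination Real.pi * I * hm'

/-- The translation exchanges the first two theta constants and fixes the third. -/
theorem thetaProd_add_one (z : ℂ) : thetaProd (z + 1) = thetaProd z := by
  rw [thetaProd, thetaProd]
  simp only [jacobiTheta₂_add_one_right]
  have h1 : (1 / 2 + 1 / 2 : ℂ) = 0 + 1 := by norm_num
  have h2 : (z + 1) / 2 + 1 / 2 = z / 2 + 1 := by ring
  rw [h1, h2, jacobiTheta₂_add_left, jacobiTheta₂_add_left, zero_add]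
  ring

/-- The inversion fixes the first theta constant and exchanges the other two, up to nonvanishing
factors. Only the zero set matters, so these factors need not be tracked. -/
theorem thetaProd_neg_inv {z : ℂ} (hz : 0 < z.im) :
    thetaProd (-1 / z) = 0 ↔ thetaProd z = 0 := by
  have hz0 := ne_zero_of_im_pos hz
  have hne : (-I * z) ^ (1 / 2 : ℂ) ≠ 0 := by
    rw [Ne, cpow_eq_zero_iff]
    simp [hz0]
  have key : ∀ w, jacobiTheta₂ w z = 0 ↔ jacobiTheta₂ (w / z) (-1 / z) = 0 := by
    intro w
    rw [jacobiTheta₂_functional_equation w z, mul_eq_zero, or_iff_right]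
    exact mul_ne_zero (one_div_ne_zero hne) (exp_ne_zero _)
  rw [thetaProd, thetaProd]
  simp only [mul_eq_zero]
  rw [key 0, key (1 / 2), key (z / 2), zero_div]
  have e1 : z / 2 / z = 1 / 2 := by field_simp
  have e2 : 1 / 2 / z = -(-1 / z / 2) := by field_simp
  rw [e1, e2, jacobiTheta₂_neg_left]
  tauto

theorem thetaProd_smul_eq_zero (γ : SL(2, ℤ)) (τ : UpperHalfPlane) :
    thetaProd (γ • τ : UpperHalfPlane) = 0 ↔ thetaProd τ = 0 := by
  have : γ ∈ Subgroup.closure {ModularGroup.S, ModularGroup.T} := by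
    simp [SpecialLinearGroup.SL2Z_generators]
  induction this using Subgroup.closure_induction generalizing τ with
  | one => simp
  | mem g hg =>
    rcases hg with rfl | hg
    · rw [UpperHalfPlane.modular_S_smul, ← thetaProd_neg_inv τ.im_pos]
      simp only [inv_neg, neg_div, one_div]
    · rw [Set.mem_singleton_iff] at hg
      rw [hg, UpperHalfPlane.modular_T_smul, UpperHalfPlane.coe_vadd, add_comm, ofReal_one,
        thetaProd_add_one]
  | mul g h _ _ ig ih => rw [mul_smul]; exact (ig _).trans (ih _)
  | inv g _ ig => have := ig (g⁻¹ • τ); rw [smul_inv_smul] at this; exact this.symm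

theorem jacobiTheta_ne_zero_of_half_le {z : ℂ} (hz : 1 / 2 ≤ z.im) : jacobiTheta z ≠ 0 := by
  intro h0
  have hz' : 0 < z.im := by linarith
  have h := norm_jacobiTheta_sub_one_le hz'
  rw [h0] at h
  set r := Real.exp (-Real.pi * z.im)
  -- 1/3 is the threshold at which 2r/(1 - r) drops below 1. It is reached since e^{π/2} > e^{3/2} ≥
  -- (7/4)² > 3.
  have hr : r < 1 / 3 := by
    have h1 : (3 : ℝ) < Real.exp (Real.pi * z.im) := by
      have h2 : (7 / 4 : ℝ) ≤ Real.exp (3 / 4) := by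
        linarith [Real.add_one_le_exp (3 / 4 : ℝ)]
      have h3 : Real.exp (3 / 4) ^ 2 = Real.exp (3 / 2) := by
        rw [← Real.exp_nat_mul]; norm_num
      have h4 : Real.exp (3 / 2) ≤ Real.exp (Real.pi * z.im) := by
        apply Real.exp_le_exp.mpr
        nlinarith [Real.pi_gt_three]
      nlinarith
    have h5 : r = (Real.exp (Real.pi * z.im))⁻¹ := by
      rw [← Real.exp_neg, ← neg_mul]
    rw [h5, one_div]
    exact inv_strictAnti₀ (by norm_num) h1
  have hr0 : 0 < r := Real.exp_pos _
  have h1 : 2 / (1 - r) * r < 1 := by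
    rw [div_mul_eq_mul_div, div_lt_one (by linarith)]
    linarith
  simp at h
  linarith

/-- Pairing the indices n and -n-1 gives the series 2∑ e^{πi n(n+1)z} over n ≥ 0. Its tail is at
most 2r/(1 - r) with r = e^{-π} < 1/2, hence smaller than the leading term 2. -/
theorem jacobiTheta₂_half_period_ne_zero {z : ℂ} (hz : 1 / 2 ≤ z.im) :
    jacobiTheta₂ (z / 2) z ≠ 0 := by
  have hz' : 0 < z.im := by linarith
  have hs := (hasSum_jacobiTheta₂_term (z / 2) hz').nat_add_neg_add_one
  have hterm : ∀ n : ℕ, jacobiTheta₂_term n (z / 2) z + jacobiTheta₂_term (-((n : ℤ) + 1)) (z / 2) z =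
      2 * exp (Real.pi * I * (n * (n + 1)) * z) := by
    intro n
    rw [jacobiTheta₂_term, jacobiTheta₂_term, two_mul]
    push_cast
    ring_nf
  simp only [hterm] at hs
  rw [← hasSum_nat_add_iff' 1] at hs
  simp only [Finset.sum_range_one, Nat.cast_zero, zero_mul, mul_zero, exp_zero, mul_one] at hs
  set r := Real.exp (-Real.pi)
  have hr0 : 0 < r := Real.exp_pos _
  have hr : r < 1 / 2 := by
    have h1 : (2 : ℝ) < Real.exp Real.pi := by
      linarith [Real.add_one_le_exp Real.pi, Real.pi_gt_three]
    have h5 : r = (Real.exp Real.pi)⁻¹ := by rw [← Real.exp_neg]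
    rw [h5, one_div]
    exact inv_strictAnti₀ (by norm_num) h1
  have hbound : ∀ n : ℕ,
      ‖2 * exp (Real.pi * I * ((n + 1 : ℕ) * ((n + 1 : ℕ) + 1)) * z)‖ ≤ 2 * r * r ^ n := by
    intro n
    rw [norm_mul, norm_exp, mul_assoc 2 r, ← pow_succ', ← Real.exp_nat_mul]
    have e : ((Real.pi * I * ((n + 1 : ℕ) * ((n + 1 : ℕ) + 1)) * z) : ℂ) =
        ((Real.pi * ((n + 1) * (n + 2)) : ℝ) : ℂ) * (I * z) := by
      push_cast; ring
    rw [e, re_ofReal_mul]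
    simp only [Complex.norm_ofNat, mul_re, I_re, zero_mul, I_im, one_mul, zero_sub]
    refine mul_le_mul_of_nonneg_left (Real.exp_le_exp.mpr ?_) (by norm_num)
    push_cast
    have hn : (0 : ℝ) ≤ n := n.cast_nonneg
    have h1 : (1 : ℝ) ≤ (n + 2) * z.im := by nlinarith
    have h2 : 0 < Real.pi * (n + 1) := by have := Real.pi_pos; positivity
    nlinarith [mul_le_mul_of_nonneg_left h1 h2.le]
  have hg := (hasSum_geometric_of_lt_one hr0.le (by linarith)).mul_left (2 * r)
  intro h0
  have hle := hs.norm_le_of_bounded hg hbound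
  rw [h0] at hle
  simp only [zero_sub, norm_neg, Complex.norm_ofNat] at hle
  rw [← div_eq_mul_inv, le_div_iff₀ (by linarith)] at hle
  linarith

/-- The zero set of the product of the three theta constants is invariant under SL₂(ℤ). Every orbit
has a point of height at least 1/2, where the leading term of each factor dominates. -/
theorem theta_ne_zero (τ : UpperHalfPlane) : theta τ ≠ 0 := by
  have him : 0 < (2 * (τ : ℂ)).im := by simpa using τ.im_pos
  set τ' : UpperHalfPlane := ⟨2 * τ, him⟩ with hτ'
  obtain ⟨γ, hγ⟩ := ModularGroup.exists_one_half_le_im_smul τ'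
  have h1 : thetaProd (γ • τ' : UpperHalfPlane) ≠ 0 := by
    refine mul_ne_zero (mul_ne_zero ?_ ?_) ?_
    · rw [← jacobiTheta_eq_jacobiTheta₂]
      exact jacobiTheta_ne_zero_of_half_le hγ
    · have := jacobiTheta_ne_zero_of_half_le (z := (γ • τ' : UpperHalfPlane) + 1)
        (by simpa using hγ)
      rwa [jacobiTheta_eq_jacobiTheta₂, jacobiTheta₂_add_one_right, zero_add] at this
    · exact jacobiTheta₂_half_period_ne_zero hγ
  rw [Ne, thetaProd_smul_eq_zero, thetaProd] at h1
  rw [theta_eq_jacobiTheta, jacobiTheta_eq_jacobiTheta₂]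
  exact left_ne_zero_of_mul (left_ne_zero_of_mul h1)

/-! ### Generators of `Γ₀(4)` -/

/-- The matrix `(1, 0; 4, 1)`. -/
def lowerFour : SL(2, ℤ) := ⟨!![1, 0; 4, 1], by simp [Matrix.det_fin_two]⟩

theorem coe_lowerFour : (lowerFour : Matrix (Fin 2) (Fin 2) ℤ) = !![1, 0; 4, 1] := rfl

theorem lowerFour_zpow (n : ℤ) :
    ((lowerFour ^ n : SL(2, ℤ)) : Matrix (Fin 2) (Fin 2) ℤ) = !![1, 0; 4 * n, 1] := by
  induction n with
  | zero => simp [Matrix.one_fin_two]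
  | succ n ih =>
    rw [zpow_add, zpow_one, Matrix.SpecialLinearGroup.coe_mul, ih, coe_lowerFour]
    ext i j
    fin_cases i <;> fin_cases j <;> simp [Matrix.mul_apply, Fin.sum_univ_two]; ring
  | pred n ih =>
    rw [zpow_sub, zpow_one, Matrix.SpecialLinearGroup.coe_mul, ih,
      Matrix.SpecialLinearGroup.coe_inv, coe_lowerFour, Matrix.adjugate_fin_two]
    ext i j
    fin_cases i <;> fin_cases j <;> simp [Matrix.mul_apply, Fin.sum_univ_two]; ring

theorem exists_two_mul_abs_add_mul_le (x : ℤ) {m : ℤ} (hm : m ≠ 0) :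
    ∃ n : ℤ, 2 * |x + n * m| ≤ |m| := by
  have h0 := Int.emod_nonneg x hm
  have h1 := Int.emod_lt_abs x hm
  have h2 := Int.emod_add_mul_ediv x m
  rcases le_total (2 * (x % m)) |m| with h | h
  · refine ⟨-(x / m), ?_⟩
    rw [show x + -(x / m) * m = x % m by linarith, abs_of_nonneg h0]
    exact h
  · obtain ⟨s, hs⟩ : ∃ s : ℤ, |m| = s * m := by
      rcases abs_choice m with h | h
      · exact ⟨1, by rw [h]; ring⟩
      · exact ⟨-1, by rw [h]; ring⟩
    refine ⟨-(x / m) - s, ?_⟩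
    rw [show x + (-(x / m) - s) * m = x % m - |m| by rw [hs]; linarith, abs_of_nonpos (by linarith)]
    linarith

/-- Descent on |c| for the lower row (c, d): powers of T reduce d modulo c, then powers of
`lowerFour` reduce c modulo 4d. At c = 0 only ± a power of T is left. -/
theorem Gamma0_four_le_closure :
    CongruenceSubgroup.Gamma0 4 ≤ Subgroup.closure {-1, ModularGroup.T, lowerFour} := by
  have hneg : (-1 : SL(2, ℤ)) ∈ Subgroup.closure {-1, ModularGroup.T, lowerFour} :=
    Subgroup.subset_closure (by simp)
  have hT : ModularGroup.T ∈ Subgroup.closure {-1, ModularGroup.T, lowerFour} :=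
    Subgroup.subset_closure (by simp)
  have hV : lowerFour ∈ Subgroup.closure {-1, ModularGroup.T, lowerFour} :=
    Subgroup.subset_closure (by simp)
  suffices ∀ (n : ℕ) (γ : SL(2, ℤ)), (γ 1 0).natAbs = n → (4 : ℤ) ∣ γ 1 0 →
      γ ∈ Subgroup.closure {-1, ModularGroup.T, lowerFour} by
    intro γ hγ
    refine this _ γ rfl ?_
    rw [CongruenceSubgroup.Gamma0_mem] at hγ
    exact_mod_cast (ZMod.intCast_zmod_eq_zero_iff_dvd _ 4).mp hγ
  intro n
  induction n using Nat.strong_induction_on with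
  | _ n ih =>
  intro γ hn h4
  have hdet : γ 0 0 * γ 1 1 - γ 0 1 * γ 1 0 = 1 := by
    rw [← Matrix.det_fin_two]; exact γ.det_coe
  by_cases hc : γ 1 0 = 0
  · rw [hc, mul_zero, sub_zero] at hdet
    rcases Int.mul_eq_one_iff_eq_one_or_neg_one.mp hdet with ⟨ha, hd⟩ | ⟨ha, hd⟩
    · have : γ = ModularGroup.T ^ (γ 0 1) := by
        ext i j
        rw [ModularGroup.coe_T_zpow]
        fin_cases i <;> fin_cases j <;> simp [ha, hc, hd]
      rw [this]
      exact Subgroup.zpow_mem _ hT _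
    · have : γ = -1 * ModularGroup.T ^ (-(γ 0 1)) := by
        ext i j
        rw [Matrix.SpecialLinearGroup.coe_mul, ModularGroup.coe_T_zpow]
        fin_cases i <;> fin_cases j <;> simp [ha, hc, hd]
      rw [this]
      exact Subgroup.mul_mem _ hneg (Subgroup.zpow_mem _ hT _)
  · obtain ⟨m, hm⟩ := exists_two_mul_abs_add_mul_le (γ 1 1) hc
    set d := γ 1 1 + m * γ 1 0 with hd
    obtain ⟨c, hc4⟩ := h4
    have hodd : d % 2 = 1 ∨ d % 2 = -1 := by
      have : ¬ (2 : ℤ) ∣ d := by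
        rintro ⟨e, he⟩
        have h1 : γ 1 1 = 2 * e - m * (4 * c) := by rw [← he, hd, hc4]; ring
        rw [h1, hc4] at hdet
        have : (2 : ℤ) ∣ 1 := ⟨γ 0 0 * (e - 2 * m * c) - 2 * (γ 0 1 * c), by linarith⟩
        omega
      omega
    have hd0 : 4 * d ≠ 0 := by omega
    obtain ⟨l, hl⟩ := exists_two_mul_abs_add_mul_le (γ 1 0) hd0
    have hmul : (γ * ModularGroup.T ^ m * lowerFour ^ l) 1 0 = γ 1 0 + l * (4 * d) := by
      rw [Matrix.SpecialLinearGroup.coe_mul, Matrix.SpecialLinearGroup.coe_mul, lowerFour_zpow,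
        ModularGroup.coe_T_zpow]
      simp [Matrix.mul_apply, Fin.sum_univ_two, hd]
      ring
    -- The reductions give 2|d| ≤ |c| and 2|c + 4ld| ≤ 4|d|. The first is strict because d is odd
    -- while |c|/2 is even, so the lower left entry really shrinks.
    have hlt : |γ 1 0 + l * (4 * d)| < |γ 1 0| := by
      have h5 : |d| % 2 = 1 := by
        rcases abs_choice d with h | h <;> rw [h] <;> omega
      have h6 : |4 * d| = 4 * |d| := abs_mul 4 d
      have h7 : |γ 1 0| = 4 * |c| := by rw [hc4]; exact abs_mul 4 c
      rw [h6] at hl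
      rw [h7] at hm ⊢
      omega
    have hmem := ih _ (by rw [← hn]; zify; rw [hmul]; exact hlt)
      (γ * ModularGroup.T ^ m * lowerFour ^ l) rfl
      (by rw [hmul, hc4]; exact ⟨c + l * d, by ring⟩)
    have : γ = γ * ModularGroup.T ^ m * lowerFour ^ l * lowerFour ^ (-l) * ModularGroup.T ^ (-m) := by
      group
    rw [this]
    exact Subgroup.mul_mem _ (Subgroup.mul_mem _ hmem (Subgroup.zpow_mem _ hV _))
      (Subgroup.zpow_mem _ hT _)

/-! ### A criterion for modularity -/

/-- The sequence `c` has polynomial growth, and the function `f = ∑ c n q^n` is such that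
`(-2iz)^{-1/2} z^{-k} f(-1/(4z))` has period `1`. -/
def ModularCoeff (k : ℕ) (c : ℕ → ℝ) : Prop :=
  PolyBdd c ∧ ∃ g : ℂ → ℂ, (∀ z : ℂ, 0 < z.im → g (z + 1) = g z) ∧
    ∀ z : ℂ, 0 < z.im → qSeries c (-1 / (4 * z)) = sqrtFactor z * z ^ k * g z

theorem ModularCoeff.add {k : ℕ} {c d : ℕ → ℝ} (hc : ModularCoeff k c) (hd : ModularCoeff k d) :
    ModularCoeff k fun n => c n + d n := by
  obtain ⟨hc, g, hg, h⟩ := hc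
  obtain ⟨hd, g', hg', h'⟩ := hd
  refine ⟨hc.add hd, fun z => g z + g' z, fun z hz => by simp only [hg z hz, hg' z hz], fun z hz => ?_⟩
  rw [qSeries_add hc hd (im_neg_inv_four_mul_pos hz), h z hz, h' z hz]
  ring

theorem ModularCoeff.smul {k : ℕ} {c : ℕ → ℝ} (hc : ModularCoeff k c) (a : ℝ) :
    ModularCoeff k fun n => a * c n := by
  obtain ⟨hc, g, hg, h⟩ := hc
  refine ⟨hc.smul a, fun z => a * g z, fun z hz => by simp only [hg z hz], fun z hz => ?_⟩
  rw [qSeries_smul, h z hz]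
  ring

theorem modularCoeff_zero (k : ℕ) : ModularCoeff k fun _ => 0 :=
  ⟨PolyBdd.const 0, fun _ => 0, fun _ _ => rfl, fun z _ => by rw [qSeries_zero]; simp⟩

theorem ModularCoeff.sum {k : ℕ} {ι : Type*} (s : Finset ι) {c : ι → ℕ → ℝ}
    (h : ∀ i ∈ s, ModularCoeff k (c i)) : ModularCoeff k fun n => ∑ i ∈ s, c i n := by
  classical
  induction s using Finset.induction_on with
  | empty => simpa using modularCoeff_zero k
  | insert a s ha ih =>
    simp only [Finset.sum_insert ha]
    exact (h a (by simp)).add (ih fun i hi => h i (by simp [hi]))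

/-- The denominator `cτ + d` of the action of `γ = (a, b; c, d)`. -/
def den (γ : SL(2, ℤ)) (z : ℂ) : ℂ := ((γ 1 0 : ℤ) : ℂ) * z + ((γ 1 1 : ℤ) : ℂ)

/-! ### Automorphy factors and the action of SL₂(ℤ) in coordinates -/

theorem den_ne_zero (γ : SL(2, ℤ)) (τ : UpperHalfPlane) : den γ τ ≠ 0 :=
  UpperHalfPlane.denom_ne_zero (γ : GL (Fin 2) ℝ) τ

theorem coe_smul_eq (γ : SL(2, ℤ)) (τ : UpperHalfPlane) :
    ((γ • τ : UpperHalfPlane) : ℂ) =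
      (((γ 0 0 : ℤ) : ℂ) * τ + ((γ 0 1 : ℤ) : ℂ)) / den γ τ := by
  rw [UpperHalfPlane.coe_specialLinearGroup_apply]
  simp [den]

theorem den_mul (γ γ' : SL(2, ℤ)) (τ : UpperHalfPlane) :
    den (γ * γ') τ = den γ (γ' • τ : UpperHalfPlane) * den γ' τ := by
  have h10 : (γ * γ') 1 0 = γ 1 0 * γ' 0 0 + γ 1 1 * γ' 1 0 := by
    simp [Matrix.SpecialLinearGroup.coe_mul, Matrix.mul_apply, Fin.sum_univ_two]
  have h11 : (γ * γ') 1 1 = γ 1 0 * γ' 0 1 + γ 1 1 * γ' 1 1 := by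
    simp [Matrix.SpecialLinearGroup.coe_mul, Matrix.mul_apply, Fin.sum_univ_two]
  have hw : ((γ' • τ : UpperHalfPlane) : ℂ) * den γ' τ =
      ((γ' 0 0 : ℤ) : ℂ) * τ + ((γ' 0 1 : ℤ) : ℂ) := by
    rw [coe_smul_eq, div_mul_cancel₀ _ (den_ne_zero γ' τ)]
  simp only [den, h10, h11] at hw ⊢
  push_cast
  linear_combination -((γ 1 0 : ℤ) : ℂ) * hw

theorem im_smul_eq (γ : SL(2, ℤ)) (τ : UpperHalfPlane) :
    (γ • τ : UpperHalfPlane).im = τ.im / ‖den γ τ‖ ^ 2 := by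
  rw [ModularGroup.im_smul_eq_div_normSq, normSq_eq_norm_sq]
  rfl

theorem coe_lowerFour_smul (τ : UpperHalfPlane) :
    ((lowerFour • τ : UpperHalfPlane) : ℂ) = τ / (4 * τ + 1) := by
  rw [coe_smul_eq, den, coe_lowerFour]
  simp

theorem coe_T_smul (τ : UpperHalfPlane) :
    ((ModularGroup.T • τ : UpperHalfPlane) : ℂ) = τ + 1 := by
  rw [UpperHalfPlane.modular_T_smul, UpperHalfPlane.coe_vadd, ofReal_one, add_comm]

theorem eq_of_gamma0_four_generators {α : Type*} {h : UpperHalfPlane → α}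
    (hT : ∀ τ, h (ModularGroup.T • τ) = h τ) (hV : ∀ τ, h (lowerFour • τ) = h τ)
    {γ : SL(2, ℤ)} (hγ : γ ∈ CongruenceSubgroup.Gamma0 4) (τ : UpperHalfPlane) :
    h (γ • τ) = h τ := by
  have hmem := Gamma0_four_le_closure hγ
  clear hγ
  induction hmem using Subgroup.closure_induction generalizing τ with
  | one => rw [one_smul]
  | mem g hg =>
    rcases hg with rfl | rfl | rfl
    · rw [ModularGroup.SL_neg_smul, one_smul]
    · exact hT τ
    · exact hV τ
  | mul g g' _ _ ig ih => rw [mul_smul]; exact (ig _).trans (ih _)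
  | inv g _ ig => have := ig (g⁻¹ • τ); rw [smul_inv_smul] at this; exact this.symm

theorem sub_one_im (z : ℂ) : (z - 1).im = z.im := by simp

/-- If `h(z + 1) = h(z)` and `h(-1/(4z))` has period `1`, then `h` is invariant under
`z ↦ z/(4z+1)`. -/
theorem apply_lowerFour_of_fricke {h H : ℂ → ℂ} (hH : ∀ z : ℂ, 0 < z.im → H (z + 1) = H z)
    (hW : ∀ z : ℂ, 0 < z.im → h (-1 / (4 * z)) = H z) (τ : UpperHalfPlane) :
    h (lowerFour • τ : UpperHalfPlane) = h τ := by
  have hτ := τ.im_pos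
  have hτ0 : (τ : ℂ) ≠ 0 := ne_zero_of_im_pos hτ
  -- The map τ ↦ τ/(4τ+1) is τ ↦ -1/(4τ), then w ↦ w - 1, then w ↦ -1/(4w) again.
  set w : ℂ := -1 / (4 * τ) with hw
  have hwim : 0 < w.im := im_neg_inv_four_mul_pos hτ
  have hwim' : 0 < (w - 1).im := by rwa [sub_one_im]
  have e1 : -1 / (4 * w) = τ := by
    rw [hw]; field_simp
  have h4 : (4 * (τ : ℂ) + 1) ≠ 0 := by
    have := den_ne_zero lowerFour τ
    rw [den, coe_lowerFour] at this
    simpa using this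
  have h5 : w - 1 = -(4 * τ + 1) / (4 * τ) := by rw [hw]; field_simp; ring
  have e2 : -1 / (4 * (w - 1)) = τ / (4 * τ + 1) := by
    rw [h5]
    field_simp
  rw [coe_lowerFour_smul, ← e2, hW _ hwim']
  conv_rhs => rw [← e1, hW _ hwim, ← sub_add_cancel w 1]
  rw [hH _ hwim']

/-- The fourth power removes the choice of square root and the multiplier: θ⁴ has weight 2 with
trivial character. This is what makes the behaviour at the cusps accessible. -/
theorem theta_pow_four_smul {γ : SL(2, ℤ)} (hγ : γ ∈ CongruenceSubgroup.Gamma0 4)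
    (τ : UpperHalfPlane) : theta (γ • τ) ^ 4 = den γ τ ^ 2 * theta τ ^ 4 := by
  have hmem := Gamma0_four_le_closure hγ
  clear hγ
  induction hmem using Subgroup.closure_induction generalizing τ with
  | one => simp [den]
  | mem g hg =>
    rcases hg with rfl | rfl | rfl
    · rw [ModularGroup.SL_neg_smul, one_smul]
      simp [den]
    · rw [theta_eq_qSeries, coe_T_smul, qSeries_add_one, ← theta_eq_qSeries, den,
        ModularGroup.coe_T]
      simp
    · have hτ0 : (τ : ℂ) ≠ 0 := ne_zero_of_im_pos τ.im_pos
      set w : ℂ := -1 / (4 * τ) with hw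
      have hwim : 0 < w.im := im_neg_inv_four_mul_pos τ.im_pos
      have hwim' : 0 < (w - 1).im := by rwa [sub_one_im]
      have h4 : (4 * (τ : ℂ) + 1) ≠ 0 := by
        have := den_ne_zero lowerFour τ
        rw [den, coe_lowerFour] at this
        simpa using this
      have h5 : w - 1 = -(4 * τ + 1) / (4 * τ) := by rw [hw]; field_simp; ring
      have e2 : -1 / (4 * (w - 1)) = τ / (4 * τ + 1) := by
        rw [h5]
        field_simp
      have hper : qSeries thetaCoeff (w - 1) = qSeries thetaCoeff w := by
        conv_rhs => rw [← sub_add_cancel w 1, qSeries_add_one]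
      rw [theta_eq_qSeries, coe_lowerFour_smul, ← e2, qSeries_thetaCoeff_fricke hwim', hper, hw,
        qSeries_thetaCoeff_fricke τ.im_pos, ← hw, ← theta_eq_qSeries, den, coe_lowerFour]
      have s1 : sqrtFactor (w - 1) ^ 4 = (-2 * I * (w - 1)) ^ 2 := by
        rw [← sqrtFactor_sq]; ring
      have s2 : sqrtFactor τ ^ 4 = (-2 * I * τ) ^ 2 := by
        rw [← sqrtFactor_sq]; ring
      rw [mul_pow, mul_pow, s1, s2, h5]
      simp only [mul_pow, I_sq]
      field_simp
      simp
      ring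
  | mul g g' _ _ ig ih =>
    rw [mul_smul, den_mul]
    rw [ig (g' • τ), ih τ]
    ring
  | inv g _ ig =>
    have h1 := ig (g⁻¹ • τ)
    rw [smul_inv_smul] at h1
    have h2 := den_mul g g⁻¹ τ
    rw [mul_inv_cancel] at h2
    have h3 : den 1 (τ : ℂ) = 1 := by simp [den]
    rw [h3] at h2
    rw [h1]
    calc theta (g⁻¹ • τ) ^ 4 = (den g (g⁻¹ • τ : UpperHalfPlane) * den g⁻¹ τ) ^ 2 *
          theta (g⁻¹ • τ) ^ 4 := by rw [← h2]; ring
      _ = _ := by ring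

theorem ModularCoeff.transform {k : ℕ} {c : ℕ → ℝ} (hc : ModularCoeff k c) {γ : SL(2, ℤ)}
    (hγ : γ ∈ CongruenceSubgroup.Gamma0 4) (τ : UpperHalfPlane) :
    qSeries c (γ • τ : UpperHalfPlane) = autFactor γ τ ^ (2 * k + 1) * qSeries c τ := by
  obtain ⟨-, g, hg, h⟩ := hc
  have key : qSeries c (γ • τ : UpperHalfPlane) /
      qSeries thetaCoeff (γ • τ : UpperHalfPlane) ^ (2 * k + 1) =
      qSeries c τ / qSeries thetaCoeff τ ^ (2 * k + 1) := by
    refine eq_of_gamma0_four_generators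
      (h := fun τ : UpperHalfPlane => qSeries c τ / qSeries thetaCoeff τ ^ (2 * k + 1))
      (fun τ => ?_) (fun τ => ?_) hγ τ
    · simp only [coe_T_smul, qSeries_add_one]
    · refine apply_lowerFour_of_fricke
        (h := fun z => qSeries c z / qSeries thetaCoeff z ^ (2 * k + 1))
        -- θ^{2k+1} acquires `sqrtFactor` to the power 2k + 1, that is, one square root times
        -- (-2iz)^k. The square root and z^k cancel against those of f, leaving only the constant
        -- (-2i)^k.
        (H := fun z => g z / ((-2 * I) ^ k * qSeries thetaCoeff z ^ (2 * k + 1)))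
        (fun z hz => ?_) (fun z hz => ?_) τ
      · simp only [qSeries_add_one, hg z hz]
      · rw [h z hz, qSeries_thetaCoeff_fricke hz, mul_pow, pow_succ (sqrtFactor z), pow_mul,
          sqrtFactor_sq, mul_pow (-2 * I) z]
        have h1 := sqrtFactor_ne_zero hz
        have h2 := ne_zero_of_im_pos hz
        have h3 : (-2 * I) ≠ 0 := by simp
        have h4 : qSeries thetaCoeff z ≠ 0 := by
          have := theta_ne_zero ⟨z, hz⟩
          rwa [theta_eq_qSeries] at this
        field_simp
  have h1 := theta_ne_zero (γ • τ)
  have h2 := theta_ne_zero τ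
  rw [← theta_eq_qSeries, ← theta_eq_qSeries] at key
  rw [autFactor, div_pow]
  field_simp at key ⊢
  linear_combination key

/-! ### Boundedness at the cusps -/

theorem exists_abs_sub_mul_le (x : ℝ) {h : ℝ} (hh : 0 < h) :
    ∃ n : ℤ, 0 ≤ x + n * h ∧ x + n * h ≤ h := by
  refine ⟨-⌊x / h⌋, ?_, ?_⟩
  · have := Int.floor_le (x / h)
    rw [le_div_iff₀ hh] at this
    push_cast
    linarith
  · have := (Int.lt_floor_add_one (x / h)).le
    rw [div_le_iff₀ hh] at this
    push_cast
    linarith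

/-- A periodic holomorphic function of moderate growth in a vertical strip is bounded at `i∞`. -/
theorem bounded_of_periodic_of_moderate_growth {g : ℂ → ℂ} {h : ℝ} (hh : 0 < h)
    (hg : Function.Periodic g h) (hd : ∀ z : ℂ, 0 < z.im → DifferentiableAt ℂ g z) {C : ℝ} {M : ℕ}
    (hbd : ∀ z : ℂ, 1 ≤ z.im → 0 ≤ z.re → z.re ≤ h → ‖g z‖ ≤ C * z.im ^ M) :
    ∃ A B : ℝ, ∀ z : ℂ, A ≤ z.im → ‖g z‖ ≤ B := by
  open Filter Topology Function.Periodic in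
  have hbd' : ∀ z : ℂ, 1 ≤ z.im → ‖g z‖ ≤ C * z.im ^ M := by
    intro z hz
    obtain ⟨n, h0, h1⟩ := exists_abs_sub_mul_le z.re hh
    have h2 : g (z + n * h) = g z := by
      simpa using (hg.int_mul n) z
    have him : (z + n * h).im = z.im := by simp
    have hre : (z + n * h).re = z.re + n * h := by simp
    rw [← h2, ← him]
    exact hbd _ (by rwa [him]) (by rwa [hre]) (by rwa [hre])
  set I' : Filter ℂ := comap im atTop with hI'
  have him : Tendsto im I' atTop := tendsto_comap
  -- The exponential decay of q = e^{2πiz/h} beats polynomial growth, so q·G(q) → 0 and the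
  -- singularity of G at q = 0 is removable.
  have h1 : Tendsto (fun z => qParam h z * g z) I' (𝓝 0) := by
    have h2 : Tendsto (fun y : ℝ => C * (y ^ M * Real.exp (-(2 * Real.pi / h) * y))) atTop
        (𝓝 0) := by
      have hpos : 0 < 2 * Real.pi / h := by have := Real.pi_pos; positivity
      have h4 := (isLittleO_pow_exp_pos_mul_atTop M hpos).tendsto_div_nhds_zero
      have h5 := h4.const_mul C
      rw [mul_zero] at h5
      refine h5.congr fun y => ?_
      rw [neg_mul, Real.exp_neg, div_eq_mul_inv]
    refine squeeze_zero_norm' ?_ (h2.comp him)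
    filter_upwards [him.eventually (eventually_ge_atTop 1)] with z hz
    rw [norm_mul, norm_qParam, mul_comm]
    simp only [Function.comp]
    rw [← mul_assoc]
    have e : -2 * Real.pi * z.im / h = -(2 * Real.pi / h) * z.im := by ring
    rw [e]
    exact mul_le_mul_of_nonneg_right (hbd' z hz) (Real.exp_pos _).le
  set G := cuspFunction h g with hG
  have h2 : Tendsto (fun q => q * G q) (𝓝[≠] 0) (𝓝 0) := by
    refine (h1.comp (invQParam_tendsto hh)).congr' ?_
    filter_upwards [self_mem_nhdsWithin] with q hq
    have hq0 : q ≠ 0 := hq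
    rw [Function.comp, qParam_right_inv hh.ne' hq0, hG, cuspFunction_eq_of_nonzero _ _ hq0]
  have h3 : Tendsto (fun q => q * (G q - G 0)) (𝓝[≠] 0) (𝓝 0) := by
    have h4 : Tendsto (fun q : ℂ => q * G 0) (𝓝[≠] 0) (𝓝 0) := by
      have : Tendsto (fun q : ℂ => q * G 0) (𝓝 0) (𝓝 (0 * G 0)) :=
        (continuous_id.mul continuous_const).tendsto 0
      rw [zero_mul] at this
      exact this.mono_left nhdsWithin_le_nhds
    simpa [mul_sub] using h2.sub h4
  have hlo : (fun q => G q - G 0) =o[𝓝[≠] 0] fun q => (q - 0)⁻¹ := by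
    rw [Asymptotics.isLittleO_iff_tendsto']
    · refine h3.congr fun q => ?_
      rw [sub_zero, div_inv_eq_mul, mul_comm]
    · filter_upwards [self_mem_nhdsWithin] with q hq hq'
      have hq0 : q ≠ 0 := hq
      simp [hq0] at hq'
  have hdiff : ∀ᶠ q in 𝓝[≠] 0, DifferentiableAt ℂ G q :=
    eventually_differentiableAt_cuspFunction_nhds_ne_zero hh hg
      ((him.eventually (eventually_gt_atTop 0)).mono fun z hz => hd z hz)
  have hlim := tendsto_limUnder_of_differentiable_on_punctured_nhds_of_isLittleO hdiff hlo
  have hb := (hlim.norm.comp (qParam_tendsto hh)).eventually_le_const (lt_add_one _)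
  rw [eventually_comap] at hb
  obtain ⟨A, hA⟩ := eventually_atTop.mp hb
  refine ⟨A, ‖limUnder (𝓝[≠] 0) G‖ + 1, fun z hz => ?_⟩
  have := hA z.im hz z rfl
  simp only [Function.comp] at this
  rwa [hG, eq_cuspFunction hh.ne' hg] at this

theorem one_le_norm_den (γ : SL(2, ℤ)) (τ : UpperHalfPlane) (hτ : 1 ≤ τ.im) :
    1 ≤ ‖den γ τ‖ := by
  by_cases hc : γ 1 0 = 0
  · have hdet : γ 0 0 * γ 1 1 - γ 0 1 * γ 1 0 = 1 := by
      rw [← Matrix.det_fin_two]; exact γ.det_coe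
    rw [hc, mul_zero, sub_zero] at hdet
    have hd : γ 1 1 = 1 ∨ γ 1 1 = -1 := by
      rcases Int.mul_eq_one_iff_eq_one_or_neg_one.mp hdet with h | h
      · exact Or.inl h.2
      · exact Or.inr h.2
    rcases hd with h | h <;> simp [den, hc, h]
  · refine le_trans ?_ (abs_im_le_norm _)
    have him : (den γ τ).im = (γ 1 0 : ℝ) * τ.im := by simp [den]
    have h1 : (1 : ℝ) ≤ |((γ 1 0 : ℤ) : ℝ)| := by
      exact_mod_cast Int.one_le_abs hc
    rw [him, abs_mul, abs_of_pos τ.im_pos]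
    nlinarith

theorem exists_norm_den_le (γ : SL(2, ℤ)) : ∃ L : ℝ, 0 ≤ L ∧ ∀ τ : UpperHalfPlane,
    1 ≤ τ.im → 0 ≤ τ.re → τ.re ≤ 4 → ‖den γ τ‖ ≤ L * τ.im := by
  -- For Re τ in [0, 4] and Im τ ≥ 1 one has |τ| ≤ 4 + Im τ ≤ 5 Im τ.
  refine ⟨5 * |((γ 1 0 : ℤ) : ℝ)| + |((γ 1 1 : ℤ) : ℝ)|, by positivity, fun τ h1 h2 h3 => ?_⟩
  have hτ : ‖(τ : ℂ)‖ ≤ 5 * τ.im := by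
    refine (norm_le_abs_re_add_abs_im _).trans ?_
    rw [UpperHalfPlane.coe_re, UpperHalfPlane.coe_im, abs_of_nonneg h2, abs_of_pos τ.im_pos]
    linarith
  refine (norm_add_le _ _).trans ?_
  rw [norm_mul, norm_intCast, norm_intCast]
  nlinarith [abs_nonneg ((γ 1 0 : ℤ) : ℝ), abs_nonneg ((γ 1 1 : ℤ) : ℝ)]

/-- The lower left entry is -4c². Hence 4 is a common period at all cusps. -/
theorem T_pow_four_conj_mem (γ : SL(2, ℤ)) :
    γ * ModularGroup.T ^ 4 * γ⁻¹ ∈ CongruenceSubgroup.Gamma0 4 := by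
  rw [CongruenceSubgroup.Gamma0_mem]
  have h : (γ * ModularGroup.T ^ 4 * γ⁻¹) 1 0 = 4 * (-(γ 1 0) ^ 2) := by
    rw [Matrix.SpecialLinearGroup.coe_mul, Matrix.SpecialLinearGroup.coe_mul,
      Matrix.SpecialLinearGroup.coe_inv, Matrix.adjugate_fin_two]
    have hT : ((ModularGroup.T ^ 4 : SL(2, ℤ)) : Matrix (Fin 2) (Fin 2) ℤ) = !![1, 4; 0, 1] := by
      exact_mod_cast ModularGroup.coe_T_zpow 4
    rw [hT]
    simp [Matrix.mul_apply, Fin.sum_univ_two]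
    ring
  rw [h]
  push_cast
  rw [show (4 : ZMod 4) = 0 from rfl, zero_mul]

theorem coe_T_pow_four_smul (τ : UpperHalfPlane) :
    ((ModularGroup.T ^ 4 • τ : UpperHalfPlane) : ℂ) = τ + 4 := by
  have := ModularGroup.coe_T_zpow_smul_eq τ (n := 4)
  exact_mod_cast this

/-- The fourth power of f has the honest factor (cτ + d)^{4k+2}, so the quotient is 4-periodic. It
grows moderately in a strip of width 4, since Im γτ is bounded below by a multiple of 1/Im τ there.
-/
theorem ModularCoeff.bounded_at_cusp {k : ℕ} {c : ℕ → ℝ} (hc : ModularCoeff k c)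
    (γ : SL(2, ℤ)) : ∃ A B : ℝ, ∀ τ : UpperHalfPlane, A ≤ τ.im →
      ‖qSeries c (γ • τ : UpperHalfPlane) ^ 4 / den γ τ ^ (4 * k + 2)‖ ≤ B := by
  set G : UpperHalfPlane → ℂ :=
    fun τ => qSeries c (γ • τ : UpperHalfPlane) ^ 4 / den γ τ ^ (4 * k + 2) with hG
  have hper : ∀ τ : UpperHalfPlane, G (ModularGroup.T ^ 4 • τ) = G τ := by
    intro τ
    have hmem := T_pow_four_conj_mem γ
    set δ := γ * ModularGroup.T ^ 4 * γ⁻¹ with hδ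
    have e1 : γ • ModularGroup.T ^ 4 • τ = δ • γ • τ := by
      rw [hδ, ← mul_smul, ← mul_smul, inv_mul_cancel_right]
    have e2 : den γ (ModularGroup.T ^ 4 • τ : UpperHalfPlane) =
        den δ (γ • τ : UpperHalfPlane) * den γ τ := by
      rw [← den_mul, hδ, inv_mul_cancel_right, den_mul]
      have hT : ((ModularGroup.T ^ 4 : SL(2, ℤ)) : Matrix (Fin 2) (Fin 2) ℤ) =
          !![1, 4; 0, 1] := by
        exact_mod_cast ModularGroup.coe_T_zpow 4
      have : den (ModularGroup.T ^ 4) τ = 1 := by rw [den, hT]; simp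
      rw [this, mul_one]
    have h4 : autFactor δ (γ • τ) ^ 4 = den δ (γ • τ : UpperHalfPlane) ^ 2 := by
      rw [autFactor, div_pow, theta_pow_four_smul hmem]
      exact mul_div_cancel_right₀ _ (pow_ne_zero _ (theta_ne_zero _))
    have hd := den_ne_zero δ (γ • τ)
    have hd' := den_ne_zero γ τ
    simp only [hG]
    rw [e1, hc.transform hmem, e2, mul_pow, ← pow_mul, mul_comm (2 * k + 1) 4, pow_mul, h4,
      ← pow_mul, mul_pow]
    field_simp
    ring
  have hperC : Function.Periodic (G ∘ UpperHalfPlane.ofComplex) ((4 : ℝ) : ℂ) := by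
    intro z
    by_cases hz : 0 < z.im
    · have hz' : 0 < (z + (4 : ℝ)).im := by simpa using hz
      rw [Function.comp, Function.comp, UpperHalfPlane.ofComplex_apply_of_im_pos hz',
        UpperHalfPlane.ofComplex_apply_of_im_pos hz, ← hper ⟨z, hz⟩]
      congr 1
      ext
      rw [coe_T_pow_four_smul]
      simp
    · have hz' : (z + (4 : ℝ)).im ≤ 0 := by simpa using hz
      rw [Function.comp, Function.comp, UpperHalfPlane.ofComplex_apply_of_im_nonpos hz',
        UpperHalfPlane.ofComplex_apply_of_im_nonpos (not_lt.mp hz)]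
  have hdiff : ∀ z : ℂ, 0 < z.im → DifferentiableAt ℂ (G ∘ UpperHalfPlane.ofComplex) z := by
    intro z hz
    have hev : (G ∘ UpperHalfPlane.ofComplex) =ᶠ[nhds z] fun w =>
        qSeries c ((((γ 0 0 : ℤ) : ℂ) * w + ((γ 0 1 : ℤ) : ℂ)) / den γ w) ^ 4 /
          den γ w ^ (4 * k + 2) := by
      filter_upwards [(isOpen_lt continuous_const continuous_im).mem_nhds hz] with w hw
      rw [Function.comp, UpperHalfPlane.ofComplex_apply_of_im_pos hw, hG]
      simp only [coe_smul_eq]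
    refine DifferentiableAt.congr_of_eventuallyEq ?_ hev
    have h0 : den γ z ≠ 0 := den_ne_zero γ ⟨z, hz⟩
    have hden : DifferentiableAt ℂ (den γ) z := by unfold den; fun_prop
    have him : 0 < ((((γ 0 0 : ℤ) : ℂ) * z + ((γ 0 1 : ℤ) : ℂ)) / den γ z).im := by
      have := coe_smul_eq γ ⟨z, hz⟩
      simp only at this
      rw [← this]
      exact (γ • (⟨z, hz⟩ : UpperHalfPlane)).im_pos
    have hq : DifferentiableAt ℂ
        (fun w => qSeries c ((((γ 0 0 : ℤ) : ℂ) * w + ((γ 0 1 : ℤ) : ℂ)) / den γ w)) z :=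
      DifferentiableAt.comp z (g := qSeries c)
        (f := fun w => (((γ 0 0 : ℤ) : ℂ) * w + ((γ 0 1 : ℤ) : ℂ)) / den γ w)
        (hc.1.differentiableAt_qSeries him) (DifferentiableAt.div (by fun_prop) hden h0)
    exact (hq.pow 4).div (hden.pow _) (pow_ne_zero _ h0)
  obtain ⟨C, M, hC, hgrow⟩ := hc.1.norm_qSeries_le
  obtain ⟨L, hL, hLle⟩ := exists_norm_den_le γ
  have hstrip : ∀ z : ℂ, 1 ≤ z.im → 0 ≤ z.re → z.re ≤ 4 →
      ‖(G ∘ UpperHalfPlane.ofComplex) z‖ ≤ C ^ 4 * (1 + L ^ 2) ^ (M * 4) * z.im ^ (M * 4) := by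
    intro z hz h0 h4
    have hz0 : 0 < z.im := by linarith
    rw [Function.comp, UpperHalfPlane.ofComplex_apply_of_im_pos hz0]
    set τ : UpperHalfPlane := ⟨z, hz0⟩ with hτ
    have hd1 := one_le_norm_den γ τ hz
    have hd2 := hLle τ hz h0 h4
    have hy : τ.im = z.im := rfl
    rw [hy] at hd2
    have h5 : ‖qSeries c (γ • τ : UpperHalfPlane)‖ ≤ C * ((1 + L ^ 2) * z.im) ^ M := by
      refine (hgrow _ (γ • τ).im_pos).trans (mul_le_mul_of_nonneg_left ?_ hC)
      have him : (((γ • τ : UpperHalfPlane) : ℂ)).im = z.im / ‖den γ τ‖ ^ 2 := im_smul_eq γ τ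
      rw [him]
      have hpos : 0 < ‖den γ τ‖ := by linarith
      refine pow_le_pow_left₀ (by positivity) ?_ _
      rw [one_div_div, add_mul]
      refine add_le_add (by linarith) ?_
      rw [div_le_iff₀ hz0]
      calc ‖den γ τ‖ ^ 2 ≤ (L * z.im) ^ 2 := pow_le_pow_left₀ hpos.le hd2 2
        _ = L ^ 2 * z.im * z.im := by ring
    rw [hG]
    simp only [norm_div, norm_pow]
    -- The denominator can be dropped, since |cτ + d| ≥ 1 for Im τ ≥ 1.
    refine (div_le_self (by positivity) (one_le_pow₀ hd1)).trans ?_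
    calc ‖qSeries c (γ • τ : UpperHalfPlane)‖ ^ 4 ≤ (C * ((1 + L ^ 2) * z.im) ^ M) ^ 4 :=
          pow_le_pow_left₀ (norm_nonneg _) h5 4
      _ = _ := by rw [mul_pow, ← pow_mul, mul_pow, mul_assoc]
  obtain ⟨A, B, hAB⟩ := bounded_of_periodic_of_moderate_growth (by norm_num) hperC hdiff hstrip
  refine ⟨A, B, fun τ hτ => ?_⟩
  have := hAB τ hτ
  rwa [Function.comp, UpperHalfPlane.ofComplex_apply] at this

theorem ModularCoeff.isModularFormHalf {k : ℕ} {c : ℕ → ℝ} (hc : ModularCoeff k c) :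
    IsModularFormHalf k fun τ : UpperHalfPlane => qSeries c τ := by
  refine ⟨?_, fun γ hγ τ => hc.transform hγ τ, fun γ => ?_⟩
  · rw [UpperHalfPlane.mdifferentiable_iff]
    intro z hz
    have hz' : 0 < z.im := hz
    refine DifferentiableAt.differentiableWithinAt ?_
    refine (hc.1.differentiableAt_qSeries hz').congr_of_eventuallyEq ?_
    filter_upwards [(isOpen_lt continuous_const continuous_im).mem_nhds hz'] with w hw
    rw [Function.comp, UpperHalfPlane.ofComplex_apply_of_im_pos hw]
  · rw [UpperHalfPlane.isBoundedAtImInfty_iff]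
    obtain ⟨A, B, h⟩ := hc.bounded_at_cusp γ
    -- If y⁴ ≤ B and y > 1 + B ≥ 1, then y ≤ y⁴ ≤ B, which is absurd.
    refine ⟨1 + B, A, fun τ hτ => ?_⟩
    have h1 := h τ hτ
    set f := qSeries c (γ • τ : UpperHalfPlane)
    have h2 : ((((γ 1 0 : ℤ) : ℂ) * (τ : ℂ) + ((γ 1 1 : ℤ) : ℂ)) ^ (-((k : ℂ) + 1 / 2)) * f) ^ 4 =
        f ^ 4 / den γ τ ^ (4 * k + 2) := by
      rw [mul_pow, ← cpow_nat_mul, ← den,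
        show ((4 : ℕ) : ℂ) * (-((k : ℂ) + 1 / 2)) = -((4 * k + 2 : ℕ) : ℂ) by push_cast; ring,
        cpow_neg, cpow_natCast]
      ring
    have h3 := congrArg norm h2
    rw [norm_pow] at h3
    rw [← h3] at h1
    set y := ‖(((γ 1 0 : ℤ) : ℂ) * (τ : ℂ) + ((γ 1 1 : ℤ) : ℂ)) ^ (-((k : ℂ) + 1 / 2)) * f‖
    have hy : 0 ≤ y := norm_nonneg _
    by_contra hlt
    rw [not_le] at hlt
    have hB : 0 ≤ B := le_trans (by positivity) h1
    have h4 : y ≤ y ^ 4 := le_self_pow₀ (by linarith) (by norm_num)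
    linarith

/-! ### Derivatives of modular forms under `z ↦ -1/(Nz)` -/

theorem im_neg_inv_mul_pos {N : ℝ} (hN : 0 < N) {z : ℂ} (hz : 0 < z.im) :
    0 < (-1 / (N * z)).im := by
  rw [neg_div, one_div, neg_im, inv_im]
  have h4 : 0 < (N * z).im := by rw [im_ofReal_mul]; positivity
  have : 0 < normSq (N * z) := normSq_pos.mpr (ne_zero_of_im_pos h4)
  rw [neg_div, neg_neg]
  positivity

/-- The term `(u^i / i!) (Nz²)^r J(z) φ_r(z)` with `u = Nz/c`. -/
def transformTerm (c N : ℂ) (J : ℂ → ℂ) (φ : ℕ → ℂ → ℂ) (i r : ℕ) (z : ℂ) : ℂ :=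
  (N * z / c) ^ i / i.factorial * (N * z ^ 2) ^ r * J z * φ r z

/-- The powers of z and the factor J contribute (i + 2r + w)/z, and dividing by z is the same as
raising i, because u = Nz/c. Differentiating φ_r raises r instead. -/
theorem hasDerivAt_transformTerm {c N w : ℂ} (hc : c ≠ 0) (hN : N ≠ 0) {J : ℂ → ℂ}
    {φ : ℕ → ℂ → ℂ} {z : ℂ} (hz : z ≠ 0) (hJ : HasDerivAt J (w / z * J z) z)
    (hφ : ∀ n : ℕ, HasDerivAt (φ n) (c * ((n + 1) * (w + n)) * φ (n + 1) z) z) (i r : ℕ) :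
    HasDerivAt (transformTerm c N J φ i r)
      (c / (N * z ^ 2) * (((i + 1 : ℕ) : ℂ) * ((i + 1 : ℕ) - 1 + 2 * r + w) *
          transformTerm c N J φ (i + 1) r z +
        ((r + 1 : ℕ) : ℂ) * (w + (r + 1 : ℕ) - 1) * transformTerm c N J φ i (r + 1) z)) z := by
  have h1 : HasDerivAt (fun s : ℂ => (N * s / c) ^ i / i.factorial)
      (i * (N * z / c) ^ i / z / i.factorial) z := by
    have h0 : HasDerivAt (fun s : ℂ => N * s / c) (N / c) z := by
      simpa using ((hasDerivAt_id z).const_mul N).div_const c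
    have h := (h0.pow i).div_const (i.factorial : ℂ)
    have e : (i : ℂ) * (N * z / c) ^ (i - 1) * (N / c) / (i.factorial : ℂ) =
        i * (N * z / c) ^ i / z / i.factorial := by
      rcases i with _ | i
      · simp
      · rw [Nat.add_sub_cancel, pow_succ]
        field_simp
    rw [e] at h
    exact h
  have h2 : HasDerivAt (fun s : ℂ => (N * s ^ 2) ^ r) (2 * r * (N * z ^ 2) ^ r / z) z := by
    have h0 : HasDerivAt (fun s : ℂ => N * s ^ 2) (N * (2 * z)) z := by
      simpa using ((hasDerivAt_id z).pow 2).const_mul N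
    have h := h0.pow r
    have e : (r : ℂ) * (N * z ^ 2) ^ (r - 1) * (N * (2 * z)) = 2 * r * (N * z ^ 2) ^ r / z := by
      rcases r with _ | r
      · simp
      · rw [Nat.add_sub_cancel, pow_succ]
        field_simp
        ring
    rw [e] at h
    exact h
  have h := ((h1.mul h2).mul hJ).mul (hφ r)
  have hi : (i.factorial : ℂ) ≠ 0 := by exact_mod_cast i.factorial_ne_zero
  have hi1 : ((i : ℂ) + 1) ≠ 0 := by exact_mod_cast i.succ_ne_zero
  refine (h.congr_deriv ?_)
  simp only [transformTerm, Pi.mul_apply, Nat.factorial_succ, pow_succ]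
  push_cast
  field_simp
  ring

/-- After shifting indices, the term with i + r = n + 1 has coefficient i(i - 1 + 2r + w) + r(w + r
- 1), which depends only on i + r and equals (n + 1)(w + n). -/
theorem sum_antidiagonal_transformTerm (c N w : ℂ) (J : ℂ → ℂ) (φ : ℕ → ℂ → ℂ) (n : ℕ) (z : ℂ) :
    ∑ p ∈ Finset.HasAntidiagonal.antidiagonal n,
      (((p.1 + 1 : ℕ) : ℂ) * ((p.1 + 1 : ℕ) - 1 + 2 * p.2 + w) *
          transformTerm c N J φ (p.1 + 1) p.2 z +
        ((p.2 + 1 : ℕ) : ℂ) * (w + (p.2 + 1 : ℕ) - 1) *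
          transformTerm c N J φ p.1 (p.2 + 1) z) =
    ((n : ℂ) + 1) * (w + n) * ∑ p ∈ Finset.HasAntidiagonal.antidiagonal (n + 1),
      transformTerm c N J φ p.1 p.2 z := by
  have h1 := Finset.Nat.sum_antidiagonal_succ (n := n) (f := fun p : ℕ × ℕ =>
    (p.1 : ℂ) * (p.1 - 1 + 2 * p.2 + w) * transformTerm c N J φ p.1 p.2 z)
  have h2 := Finset.Nat.sum_antidiagonal_succ' (n := n) (f := fun p : ℕ × ℕ =>
    (p.2 : ℂ) * (w + p.2 - 1) * transformTerm c N J φ p.1 p.2 z)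
  simp only [Nat.cast_zero, zero_mul, zero_add, add_zero] at h1 h2
  rw [Finset.sum_add_distrib, ← h1, ← h2, ← Finset.sum_add_distrib, Finset.mul_sum]
  refine Finset.sum_congr rfl fun p hp => ?_
  have hp' : (p.1 : ℂ) + p.2 = n + 1 := by
    exact_mod_cast Finset.HasAntidiagonal.mem_antidiagonal.mp hp
  have hp1 : (p.1 : ℂ) = n + 1 - p.2 := by rw [← hp']; ring
  rw [hp1]
  ring

/-- If `φ_0` transforms under `z ↦ -1/(Nz)` like a modular form of weight `w` (or, for `w = 2`,
like a quasimodular form), then so do the suitably normalised derivatives `φ_n`, up to lower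
derivatives. -/
theorem derivatives_transform {c w κ : ℂ} {N : ℝ} (hc : c ≠ 0) (hN : 0 < N)
    (hw : ∀ n : ℕ, w + n ≠ 0) (hκ : κ = 0 ∨ w = 2) {J : ℂ → ℂ}
    (hJ : ∀ z : ℂ, 0 < z.im → HasDerivAt J (w / z * J z) z) {φ : ℕ → ℂ → ℂ}
    (hφ : ∀ (n : ℕ) (z : ℂ), 0 < z.im →
      HasDerivAt (φ n) (c * ((n + 1) * (w + n)) * φ (n + 1) z) z)
    (h0 : ∀ z : ℂ, 0 < z.im → φ 0 (-1 / (N * z)) = J z * φ 0 z + κ * z) (n : ℕ) :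
    ∀ z : ℂ, 0 < z.im → φ n (-1 / (N * z)) =
      ∑ p ∈ Finset.HasAntidiagonal.antidiagonal n, transformTerm c N J φ p.1 p.2 z +
        κ * c / N * ((N * z / c) ^ (n + 1) / (n + 1).factorial) := by
  have hN0 : (N : ℂ) ≠ 0 := by exact_mod_cast hN.ne'
  induction n with
  | zero =>
    intro z hz
    rw [h0 z hz]
    simp [transformTerm]
    field_simp
  | succ n ih =>
    intro z hz
    have hz0 := ne_zero_of_im_pos hz
    have hWz := im_neg_inv_mul_pos hN hz
    have hinner : HasDerivAt (fun s : ℂ => -1 / (N * s)) (1 / (N * z ^ 2)) z := by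
      have h1 : HasDerivAt (fun s : ℂ => N * s) N z := by
        simpa using (hasDerivAt_id z).const_mul (N : ℂ)
      have h2 := (hasDerivAt_const z (-1 : ℂ)).div h1 (mul_ne_zero hN0 hz0)
      refine h2.congr_deriv ?_
      field_simp
      ring
    have hL := (hφ n _ hWz).comp z hinner
    have hsum := HasDerivAt.fun_sum (u := Finset.HasAntidiagonal.antidiagonal n)
      (fun p _ => hasDerivAt_transformTerm hc hN0 hz0 (hJ z hz) (fun m => hφ m z hz) p.1 p.2)
    have hpow : HasDerivAt
        (fun s : ℂ => κ * c / N * ((N * s / c) ^ (n + 1) / (n + 1).factorial))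
        (κ * c / N * ((n + 1) * (N * z / c) ^ n * (N / c) / (n + 1).factorial)) z := by
      have h0 : HasDerivAt (fun s : ℂ => N * s / c) (N / c) z := by
        simpa using ((hasDerivAt_id z).const_mul (N : ℂ)).div_const c
      have h := ((h0.pow (n + 1)).div_const ((n + 1).factorial : ℂ)).const_mul (κ * c / N)
      simpa using h
    have hR := hsum.add hpow
    have hEq : (φ n ∘ fun s : ℂ => -1 / (N * s)) =ᶠ[nhds z] fun s =>
        ∑ p ∈ Finset.HasAntidiagonal.antidiagonal n, transformTerm c N J φ p.1 p.2 s +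
          κ * c / N * ((N * s / c) ^ (n + 1) / (n + 1).factorial) := by
      filter_upwards [(isOpen_lt continuous_const continuous_im).mem_nhds hz] with s hs
      exact ih s hs
    have huniq := hL.unique (hR.congr_of_eventuallyEq hEq)
    rw [← Finset.mul_sum, sum_antidiagonal_transformTerm] at huniq
    have hn1 : ((n : ℂ) + 1) ≠ 0 := by exact_mod_cast n.succ_ne_zero
    have hfac : ((n + 1).factorial : ℂ) ≠ 0 := by exact_mod_cast (n + 1).factorial_ne_zero
    have hn2 : ((n : ℂ) + 1 + 1) ≠ 0 := by exact_mod_cast (n + 1).succ_ne_zero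
    have hwn := hw n
    set S := ∑ p ∈ Finset.HasAntidiagonal.antidiagonal (n + 1), transformTerm c N J φ p.1 p.2 z
    -- The recursion multiplies the anomalous term by n + 1 and would need (n + 1)(w + n)/(n + 2);
    -- so a nonzero anomaly persists in this form only for w = 2.
    have hK : κ * (w + n) = κ * (n + 2) := by
      rcases hκ with h | h
      · rw [h]; ring
      · rw [h]; ring
    rw [Nat.factorial_succ (n + 1)]
    push_cast
    have key : ((n : ℂ) + 1) * (w + n) * φ (n + 1) (-1 / (N * z)) = ((n : ℂ) + 1) * (w + n) * S +
        N * z ^ 2 / c * (κ * c / N * ((n + 1) * (N * z / c) ^ n * (N / c) / (n + 1).factorial)) := by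
      have h5 : φ (n + 1) (-1 / (N * z)) * (c * ((n + 1) * (w + n)) * (1 / (N * z ^ 2))) =
          c / (N * z ^ 2) * (((n : ℂ) + 1) * (w + n) * S) +
          κ * c / N * ((n + 1) * (N * z / c) ^ n * (N / c) / (n + 1).factorial) := by
        rw [← huniq]; ring
      field_simp at h5 ⊢
      linear_combination h5
    refine mul_left_cancel₀ (mul_ne_zero hn1 hwn) (key.trans ?_)
    rw [mul_add (((n : ℂ) + 1) * (w + n))]
    congr 1
    have e : ((n : ℂ) + 1) * (w + n) * (κ * c / N * ((N * z / c) ^ (n + 1 + 1) /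
        (((n : ℂ) + 1 + 1) * (n + 1).factorial))) =
        (κ * (w + n)) * (((n : ℂ) + 1) * (c / N * ((N * z / c) ^ (n + 1 + 1) /
        (((n : ℂ) + 1 + 1) * (n + 1).factorial)))) := by ring
    have hp : (N * z / c) ^ (n + 1 + 1) = (N * z / c) ^ n * (N * z / c) * (N * z / c) := by
      rw [pow_succ, pow_succ]
    rw [e, hK, hp, show (n : ℂ) + 2 = n + 1 + 1 by ring]
    generalize (N * z / c) ^ n = V
    field_simp

/-- The algebra behind Rankin–Cohen brackets: in the alternating sum over two sequences of
derivatives, the exponential factors of their transformation laws cancel. -/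
theorem bracket_transform {A A' B B' : ℕ → ℂ} {u p q J J' κ : ℂ}
    (hA : ∀ n, A' n = ∑ s ∈ Finset.HasAntidiagonal.antidiagonal n,
      u ^ s.1 / s.1.factorial * p ^ s.2 * J * A s.2)
    (hB : ∀ n, B' n = ∑ s ∈ Finset.HasAntidiagonal.antidiagonal n,
      u ^ s.1 / s.1.factorial * q ^ s.2 * J' * B s.2 + κ * (u ^ (n + 1) / (n + 1).factorial))
    (ν : ℕ) :
    ∑ s ∈ Finset.HasAntidiagonal.antidiagonal ν, (-1) ^ s.2 * A' s.1 * B' s.2 - κ * A' (ν + 1) =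
      J * (J' * ∑ s ∈ Finset.HasAntidiagonal.antidiagonal ν,
          (-1) ^ s.2 * p ^ s.1 * q ^ s.2 * A s.1 * B s.2 - κ * p ^ (ν + 1) * A (ν + 1)) := by
  open PowerSeries in
  set E : PowerSeries ℂ := .mk fun n => u ^ n / n.factorial with hE
  set E' : PowerSeries ℂ := .mk fun n => (-u) ^ n / n.factorial with hE'
  have hEE : E * E' = 1 := by
    -- E and E' are exp(uX) and exp(-uX). The alternating signs on the second sequence turn its
    -- exponential into the inverse of the first.
    have h1 : E = rescale u (exp ℂ) := by
      ext n; simp [hE, coeff_exp, div_eq_mul_inv]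
    have h2 : E' = rescale u (evalNegHom (exp ℂ)) := by
      ext n; simp [hE', evalNegHom, coeff_exp, div_eq_mul_inv, neg_pow u]; ring
    rw [h1, h2, ← map_mul, exp_mul_exp_neg_eq_one, map_one]
  set P : PowerSeries ℂ := .mk fun n => p ^ n * A n with hP
  set Q : PowerSeries ℂ := .mk fun n => (-1) ^ n * q ^ n * B n with hQ
  have hAs : (PowerSeries.mk A') = C J * (E * P) := by
    ext n
    rw [coeff_mk, coeff_C_mul, coeff_mul, hA, Finset.mul_sum]
    refine Finset.sum_congr rfl fun s _ => ?_
    rw [hE, hP, coeff_mk, coeff_mk]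
    ring
  -- The anomalous terms sum to κ(1 - E'). Moving κ to the left makes E' a common factor, and this
  -- yields the correction by the (ν+1)-st derivative.
  have hBs : X * (PowerSeries.mk fun n => (-1) ^ n * B' n) =
      C J' * (E' * (X * Q)) + C κ * (1 - E') := by
    ext n
    rcases n with _ | n
    · simp [hE', constantCoeff_mk]
    · rw [coeff_succ_X_mul, map_add, coeff_C_mul, coeff_C_mul,
        show E' * (X * Q) = X * (E' * Q) by ring, coeff_succ_X_mul, coeff_mk, hB, map_sub, coeff_mul,
        mul_add, Finset.mul_sum, Finset.mul_sum]
      congr 1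
      · refine Finset.sum_congr rfl fun s hs => ?_
        rw [hE', hQ, coeff_mk, coeff_mk, ← Finset.HasAntidiagonal.mem_antidiagonal.mp hs,
          neg_pow u, pow_add]
        ring
      · rw [hE', coeff_mk, coeff_one, if_neg n.succ_ne_zero, neg_pow u, pow_succ (-1 : ℂ)]
        ring
  have hprod : PowerSeries.mk A' * (X * (PowerSeries.mk fun n => (-1) ^ n * B' n) - C κ) =
      C J * (P * (C J' * (X * Q) - C κ)) := by
    rw [hBs, hAs]
    linear_combination (C J * P * (C J' * (X * Q) - C κ)) * hEE
  have hcoeff := congrArg (coeff (ν + 1)) hprod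
  have e1 : PowerSeries.mk A' * (X * (PowerSeries.mk fun n => (-1) ^ n * B' n) - C κ) =
      X * (PowerSeries.mk A' * PowerSeries.mk fun n => (-1) ^ n * B' n) -
        C κ * PowerSeries.mk A' := by ring
  have e2 : P * (C J' * (X * Q) - C κ) = C J' * (X * (P * Q)) - C κ * P := by ring
  rw [e1, e2, map_sub, coeff_succ_X_mul, coeff_C_mul, coeff_C_mul, map_sub, coeff_C_mul,
    coeff_succ_X_mul, coeff_C_mul, coeff_mul, coeff_mul, coeff_mk, hP, coeff_mk] at hcoeff
  convert! hcoeff using 2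
  · refine Finset.sum_congr rfl fun s _ => ?_
    rw [coeff_mk, coeff_mk]; ring
  · rw [mul_assoc κ]
    congr 2
    refine Finset.sum_congr rfl fun s _ => ?_
    rw [hQ, coeff_mk, coeff_mk]; ring

/-! ### Eisenstein series -/

/-- The coefficients of the Eisenstein series `-B_w/(2w) + ∑ σ_{w-1}(n) q^n`. -/
def eisCoeff (w n : ℕ) : ℝ :=
  if n = 0 then -(_root_.bernoulli w : ℝ) / (2 * w) else (ArithmeticFunction.sigma (w - 1) n : ℝ)

theorem polyBdd_eisCoeff {w : ℕ} (hw : 1 ≤ w) : PolyBdd (eisCoeff w) := by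
  refine PolyBdd.of_abs_le
    ((PolyBdd.const |-(_root_.bernoulli w : ℝ) / (2 * w)|).add (PolyBdd.natCast_pow w))
    fun n => ?_
  unfold eisCoeff
  split_ifs with hn
  · have : (0 : ℝ) ≤ (n : ℝ) ^ w := by positivity
    linarith
  · have h := ArithmeticFunction.sigma_le_pow_succ (w - 1) n
    rw [Nat.sub_add_cancel hw] at h
    have h' : (ArithmeticFunction.sigma (w - 1) n : ℝ) ≤ (n : ℝ) ^ w := by exact_mod_cast h
    rw [abs_of_nonneg (Nat.cast_nonneg _)]
    have := abs_nonneg (-(_root_.bernoulli w : ℝ) / (2 * w))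
    linarith

/-- Euler's formula expresses ζ(w) through B_w, and ζ(w) ≠ 0. This is needed because the series
normalised to constant term 1 has -2w/B_w in its coefficients. -/
theorem bernoulli_ne_zero_of_even {w : ℕ} (hw : 2 ≤ w) (hw2 : Even w) :
    _root_.bernoulli w ≠ 0 := by
  obtain ⟨m, rfl⟩ := hw2.two_dvd
  intro h
  have h1 := riemannZeta_two_mul_nat (k := m) (by omega)
  rw [h] at h1
  have h2 : riemannZeta (2 * m) ≠ 0 := by
    refine riemannZeta_ne_zero_of_one_lt_re ?_
    have : (1 : ℝ) < 2 * m := by exact_mod_cast (by omega : 1 < 2 * m)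
    simpa using this
  apply h2
  rw [h1]
  simp

theorem qSeries_eisCoeff_eq_E {w : ℕ} (hw : 3 ≤ w) (hw2 : Even w) (τ : UpperHalfPlane) :
    qSeries (eisCoeff w) τ =
      -(_root_.bernoulli w : ℂ) / (2 * w) * ModularForm.E hw τ := by
  have hB : (_root_.bernoulli w : ℂ) ≠ 0 := by
    exact_mod_cast bernoulli_ne_zero_of_even (by omega) hw2
  have hw0 : (w : ℂ) ≠ 0 := by exact_mod_cast (by omega : w ≠ 0)
  have h := ModularForm.hasSum_qExpansion (f := ModularForm.E hw) (h := 1) one_pos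
    one_mem_strictPeriods_SL τ
  have h2 := h.mul_left (-(_root_.bernoulli w : ℂ) / (2 * w))
  rw [← h2.tsum_eq]
  refine tsum_congr fun n => ?_
  rw [EisensteinSeries.E_qExpansion_coeff hw hw2, qTerm, eisCoeff, Function.Periodic.qParam,
    ← exp_nat_mul]
  have e : exp (n * (2 * Real.pi * I * τ / (1 : ℝ))) = exp (2 * Real.pi * I * n * τ) := by
    congr 1; push_cast; ring
  rw [e]
  split_ifs with hn
  · push_cast; simp
  · push_cast; field_simp

theorem coe_S_smul (τ : UpperHalfPlane) :
    ((ModularGroup.S • τ : UpperHalfPlane) : ℂ) = -1 / τ := by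
  rw [UpperHalfPlane.modular_S_smul]
  simp [neg_div]

theorem E_S_smul {w : ℕ} (hw : 3 ≤ w) (τ : UpperHalfPlane) :
    ModularForm.E hw (ModularGroup.S • τ) = (τ : ℂ) ^ w * ModularForm.E hw τ := by
  refine (SlashInvariantForm.slash_action_eqn'
    (ModularForm.E hw) (γ := (ModularGroup.S : GL (Fin 2) ℝ)) (by exact ⟨_, rfl⟩) τ).trans ?_
  change ((((ModularGroup.S 1 0 : ℤ) : ℝ) : ℂ) * τ + (((ModularGroup.S 1 1 : ℤ) : ℝ) : ℂ)) ^ (w : ℤ) *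
    ModularForm.E hw τ = _
  simp [ModularGroup.S]

theorem qSeries_eisCoeff_two_eq_E2 (τ : UpperHalfPlane) :
    qSeries (eisCoeff 2) τ = -1 / 24 * EisensteinSeries.E2 τ := by
  have h := (EisensteinSeries.hasSum_qExpansion_E2 (z := τ)).mul_left (-1 / 24)
  rw [← h.tsum_eq]
  refine tsum_congr fun n => ?_
  rw [qTerm, eisCoeff, ← exp_nat_mul, bernoulli_two]
  have e : exp (n * (2 * Real.pi * I * τ)) = exp (2 * Real.pi * I * n * τ) := by
    congr 1; ring
  rw [e]
  split_ifs with hn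
  · push_cast; norm_num
  · push_cast; rw [smul_eq_mul]; ring

theorem E2_S_smul (τ : UpperHalfPlane) : EisensteinSeries.E2 (ModularGroup.S • τ) =
    (τ : ℂ) ^ 2 * EisensteinSeries.E2 τ - 6 * I / Real.pi * τ := by
  have h := EisensteinSeries.G2_S_transform τ
  have hτ := ne_zero_of_im_pos τ.im_pos
  have hpi : (Real.pi : ℂ) ≠ 0 := by exact_mod_cast Real.pi_ne_zero
  simp only [EisensteinSeries.E2, Pi.smul_apply, smul_eq_mul, riemannZeta_two]
  rw [h]
  field_simp
  ring

/-- The failure of modularity of the Eisenstein series of weight `w` under `z ↦ -1/z`. -/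
def eisDefect (w : ℕ) : ℂ := if w = 2 then I / (4 * Real.pi) else 0

theorem qSeries_eisCoeff_neg_inv {w : ℕ} (hw : 2 ≤ w) (hw2 : Even w) {z : ℂ} (hz : 0 < z.im) :
    qSeries (eisCoeff w) (-1 / z) = z ^ w * qSeries (eisCoeff w) z + eisDefect w * z := by
  have hS := coe_S_smul ⟨z, hz⟩
  simp only at hS
  rw [← hS]
  have hc : z = ((⟨z, hz⟩ : UpperHalfPlane) : ℂ) := rfl
  unfold eisDefect
  split_ifs with h
  · subst h
    rw [qSeries_eisCoeff_two_eq_E2, E2_S_smul]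
    conv_rhs => rw [hc, qSeries_eisCoeff_two_eq_E2]
    simp only
    ring
  · have hw3 : 3 ≤ w := by omega
    rw [qSeries_eisCoeff_eq_E hw3 hw2, E_S_smul]
    conv_rhs => rw [hc, qSeries_eisCoeff_eq_E hw3 hw2]
    simp only
    ring

/-! ### Rankin–Cohen brackets of the theta function and Eisenstein series -/

/-- The coefficients of the `j`-th derivative of `θ`, divided by `(2j)!`. -/
def thetaDeriv (j n : ℕ) : ℝ := (n : ℝ) ^ j * thetaCoeff n / (2 * j).factorial

/-- The coefficients of the `l`-th derivative of the Eisenstein series of weight `w`, divided by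
`l! (l + w - 1)!`. -/
def eisDeriv (w l n : ℕ) : ℝ :=
  (n : ℝ) ^ l * eisCoeff w n / (l.factorial * (l + w - 1).factorial)

theorem polyBdd_thetaDeriv (j : ℕ) : PolyBdd (thetaDeriv j) := by
  have := ((PolyBdd.natCast_pow j).mul polyBdd_thetaCoeff).smul ((2 * j).factorial : ℝ)⁻¹
  refine this.congr fun n => ?_
  rw [thetaDeriv]; ring

theorem polyBdd_eisDeriv {w : ℕ} (hw : 1 ≤ w) (l : ℕ) : PolyBdd (eisDeriv w l) := by
  have := ((PolyBdd.natCast_pow l).mul (polyBdd_eisCoeff hw)).smul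
    (l.factorial * (l + w - 1).factorial : ℝ)⁻¹
  refine this.congr fun n => ?_
  rw [eisDeriv]; ring

/-- The coefficients of the Rankin–Cohen bracket of `θ(z)` and the Eisenstein series of weight `w`
at `4z`; for `w = 2` it is corrected by a multiple of a derivative of `θ`. -/
def bracketCoeff (w ν n : ℕ) : ℝ :=
  ∑ s ∈ Finset.HasAntidiagonal.antidiagonal ν,
      (-1) ^ s.2 * cauchyProd (thetaDeriv s.1) (dilateFour (eisDeriv w s.2)) n +
    (if w = 2 then 1 / 2 else 0) * thetaDeriv (ν + 1) n

/-- The ratio of consecutive normalising factorials is (2n+2)(2n+1) = 4(n+1)(n+1/2). The factor 4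
turns 2πi into 8πi and will match the level N = 4. -/
theorem hasDerivAt_qSeries_thetaDeriv (n : ℕ) {z : ℂ} (hz : 0 < z.im) :
    HasDerivAt (qSeries (thetaDeriv n))
      (8 * Real.pi * I * ((n + 1) * (1 / 2 + n)) * qSeries (thetaDeriv (n + 1)) z) z := by
  refine ((polyBdd_thetaDeriv n).hasDerivAt_qSeries hz).congr_deriv ?_
  have : (fun m : ℕ => (m : ℝ) * thetaDeriv n m) =
      fun m => (2 * (n + 1) * (2 * n + 1) : ℝ) * thetaDeriv (n + 1) m := by
    ext m
    have h : ((2 * (n + 1)).factorial : ℝ) = (2 * n + 2) * ((2 * n + 1) * (2 * n).factorial) := by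
      rw [show 2 * (n + 1) = 2 * n + 1 + 1 by ring, Nat.factorial_succ, Nat.factorial_succ]
      push_cast; ring
    have h0 : ((2 * n).factorial : ℝ) ≠ 0 := by positivity
    rw [thetaDeriv, thetaDeriv, h]
    field_simp
    ring
  rw [this, qSeries_smul]
  push_cast
  ring

theorem hasDerivAt_qSeries_eisDeriv {w : ℕ} (hw : 1 ≤ w) (n : ℕ) {z : ℂ} (hz : 0 < z.im) :
    HasDerivAt (qSeries (eisDeriv w n))
      (2 * Real.pi * I * ((n + 1) * (w + n)) * qSeries (eisDeriv w (n + 1)) z) z := by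
  refine ((polyBdd_eisDeriv hw n).hasDerivAt_qSeries hz).congr_deriv ?_
  have : (fun m : ℕ => (m : ℝ) * eisDeriv w n m) =
      fun m => ((n + 1) * (w + n) : ℝ) * eisDeriv w (n + 1) m := by
    ext m
    have h : ((n + 1 + w - 1).factorial : ℝ) = (w + n) * (n + w - 1).factorial := by
      rw [show n + 1 + w - 1 = (n + w - 1) + 1 by omega, Nat.factorial_succ,
        show n + w - 1 + 1 = n + w by omega]
      push_cast; ring
    have h0 : ((n + w - 1).factorial : ℝ) ≠ 0 := by positivity
    have h1 : (w + n : ℝ) ≠ 0 := by positivity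
    rw [eisDeriv, eisDeriv, h, Nat.factorial_succ]
    push_cast
    field_simp
    ring
  rw [this, qSeries_smul]
  push_cast
  ring

/-- Both sequences of derivatives satisfy `derivatives_transform`, so `bracket_transform` applies to
them; the weight is 1/2 + w + 2ν. -/
theorem modularCoeff_bracketCoeff {w : ℕ} (hw : 2 ≤ w) (hw2 : Even w) (ν : ℕ) :
    ModularCoeff (w + 2 * ν) (bracketCoeff w ν) := by
  have hpi : (Real.pi : ℂ) ≠ 0 := by exact_mod_cast Real.pi_ne_zero
  have hA := polyBdd_thetaDeriv
  have hB := polyBdd_eisDeriv (w := w) (by omega)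
  have hprod : ∀ j l, PolyBdd (cauchyProd (thetaDeriv j) (dilateFour (eisDeriv w l))) :=
    fun j l => (hA j).cauchyProd (hB l).dilateFour
  have hsum : PolyBdd fun n => ∑ s ∈ Finset.HasAntidiagonal.antidiagonal ν,
      (-1) ^ s.2 * cauchyProd (thetaDeriv s.1) (dilateFour (eisDeriv w s.2)) n :=
    PolyBdd.sum _ fun s _ => (hprod s.1 s.2).smul _
  have hseries : ∀ {z : ℂ}, 0 < z.im → qSeries (bracketCoeff w ν) z =
      ∑ s ∈ Finset.HasAntidiagonal.antidiagonal ν,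
        (-1) ^ s.2 * qSeries (thetaDeriv s.1) z * qSeries (eisDeriv w s.2) (4 * z) +
      (if w = 2 then 1 / 2 else 0) * qSeries (thetaDeriv (ν + 1)) z := by
    intro z hz
    unfold bracketCoeff
    rw [qSeries_add hsum ((hA (ν + 1)).smul _) hz, qSeries_smul,
      qSeries_sum _ (fun s _ => (hprod s.1 s.2).smul _) hz]
    congr 1
    · refine Finset.sum_congr rfl fun s _ => ?_
      rw [qSeries_smul, ← qSeries_mul (hA _) (hB _).dilateFour hz, qSeries_dilateFour]
      push_cast
      ring
    · split_ifs <;> push_cast <;> ring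
  -- The witness has the Eisenstein series at z instead of 4z, because 4·(-1/(4z)) = -1/z. The
  -- powers of 4 come from (4z²)^j in the transformation of the derivatives of θ.
  refine ⟨hsum.add ((hA (ν + 1)).smul _), fun z =>
    ∑ s ∈ Finset.HasAntidiagonal.antidiagonal ν, (-1) ^ s.2 * 4 ^ s.1 *
      qSeries (thetaDeriv s.1) z * qSeries (eisDeriv w s.2) z +
      (if w = 2 then 1 / 2 else 0) * 4 ^ (ν + 1) * qSeries (thetaDeriv (ν + 1)) z,
    fun z _ => by simp only [qSeries_add_one], fun z hz => ?_⟩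
  have hz0 := ne_zero_of_im_pos hz
  have hA' := fun n => derivatives_transform (c := 8 * Real.pi * I) (w := 1 / 2) (κ := 0) (N := 4)
    (by simp [hpi]) (by norm_num)
    (fun n => by
      intro h
      have := congrArg Complex.re h
      norm_num at this
      have h0 : (0 : ℝ) ≤ n := n.cast_nonneg
      linarith)
    (Or.inl rfl) (J := sqrtFactor) (fun z hz => hasDerivAt_sqrtFactor hz)
    (φ := fun n => qSeries (thetaDeriv n)) (fun n z hz => hasDerivAt_qSeries_thetaDeriv n hz)
    (fun z hz => by
      have : thetaDeriv 0 = thetaCoeff := by ext n; simp [thetaDeriv]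
      have h := qSeries_thetaCoeff_fricke hz
      rw [this]
      push_cast
      rw [h]
      ring) n z hz
  have hB' := fun n => derivatives_transform (c := 2 * Real.pi * I) (w := w)
    (κ := eisDefect w / (w - 1).factorial) (N := 1)
    (by simp [hpi]) (by norm_num)
    (fun n => by exact_mod_cast (by omega : w + n ≠ 0))
    (by
      unfold eisDefect
      split_ifs with h
      · right; rw [h]; norm_num
      · left; simp)
    (J := fun z => z ^ w)
    (fun z hz => by
      refine (hasDerivAt_pow w z).congr_deriv ?_
      obtain ⟨v, rfl⟩ : ∃ v, w = v + 1 := ⟨w - 1, by omega⟩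
      have := ne_zero_of_im_pos hz
      rw [Nat.add_sub_cancel, pow_succ]
      field_simp)
    (φ := fun n => qSeries (eisDeriv w n))
    (fun n z hz => hasDerivAt_qSeries_eisDeriv (by omega) n hz)
    (fun z hz => by
      have : eisDeriv w 0 = fun n => ((w - 1).factorial : ℝ)⁻¹ * eisCoeff w n := by
        ext n
        rw [eisDeriv]
        simp
        ring
      rw [this, qSeries_smul, qSeries_smul, ofReal_one, one_mul,
        qSeries_eisCoeff_neg_inv hw hw2 hz]
      push_cast
      ring) n z hz
  -- Both families have the same u: 4z/(8πi) for θ and z/(2πi) for the Eisenstein series. The value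
  -- κ = -1/2 for w = 2 is i/(4π) · 2πi.
  have hbr := bracket_transform (A := fun n => qSeries (thetaDeriv n) z)
    (A' := fun n => qSeries (thetaDeriv n) (-1 / (4 * z)))
    (B := fun n => qSeries (eisDeriv w n) z) (B' := fun n => qSeries (eisDeriv w n) (-1 / z))
    (u := z / (2 * Real.pi * I)) (p := 4 * z ^ 2) (q := z ^ 2) (J := sqrtFactor z) (J' := z ^ w)
    (κ := if w = 2 then -1 / 2 else 0)
    (fun n => by
      have h := hA' n
      push_cast at h
      rw [h]
      simp only [transformTerm, zero_mul, zero_div, add_zero]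
      refine Finset.sum_congr rfl fun s _ => ?_
      rw [show 4 * z / (8 * Real.pi * I) = z / (2 * Real.pi * I) by field_simp; ring])
    (fun n => by
      have h := hB' n
      simp only [ofReal_one, one_mul] at h
      rw [h]
      simp only [transformTerm, one_mul]
      congr 2
      unfold eisDefect
      split_ifs with h
      · subst h
        field_simp
        simp
        norm_num
      · simp) ν
  rw [hseries (im_neg_inv_four_mul_pos hz),
    show 4 * (-1 / (4 * z)) = -1 / z by field_simp]
  have hneg : ∀ t : ℂ, (if w = 2 then -1 / 2 else 0 : ℂ) * t =
      -((if w = 2 then 1 / 2 else 0) * t) := fun t => by split_ifs <;> ring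
  rw [hneg, sub_neg_eq_add] at hbr
  rw [hbr, mul_assoc (sqrtFactor z)]
  congr 1
  rw [mul_add, Finset.mul_sum, Finset.mul_sum, mul_assoc, hneg, sub_neg_eq_add]
  congr 1
  · refine Finset.sum_congr rfl fun s hs => ?_
    rw [← Finset.HasAntidiagonal.mem_antidiagonal.mp hs, mul_pow, ← pow_mul, ← pow_mul, pow_add,
      mul_add, pow_add]
    ring
  · split_ifs with h
    · subst h
      rw [mul_pow, ← pow_mul, pow_add]
      ring
    · simp

end ZagierSeries

end

noncomputable section

namespace ZagierSeries

/-! ### The values of `P_{k,D}` as combinations of coefficients of Rankin–Cohen brackets -/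

/-! ### Reindexing of finite sums and symmetries of the set of forms -/

theorem sum_range_two_mul {M : Type*} [AddCommMonoid M] (f : ℕ → M) (K : ℕ) :
    ∑ j ∈ Finset.range (2 * K), f j = ∑ j ∈ Finset.range K, (f (2 * j) + f (2 * j + 1)) := by
  induction K with
  | zero => simp
  | succ K ih =>
    rw [show 2 * (K + 1) = 2 * K + 1 + 1 by ring, Finset.sum_range_succ, Finset.sum_range_succ, ih,
      Finset.sum_range_succ, add_assoc]

/-- An odd exponent gives an even number of binomial terms, so they pair off by complementary
exponents without a middle term. -/
theorem add_pow_odd (A B : ℝ) {R : ℕ} (hR : 0 < R) : (A + B) ^ (2 * R - 1) =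
    ∑ l ∈ Finset.range R, ((2 * R - 1).choose l : ℝ) *
      (A ^ (2 * R - 1 - l) * B ^ l + A ^ l * B ^ (2 * R - 1 - l)) := by
  rw [add_comm, add_pow, show 2 * R - 1 + 1 = R + R by omega, Finset.sum_range_add,
    ← Finset.sum_range_reflect (fun i => B ^ (R + i) * _ * _), ← Finset.sum_add_distrib]
  refine Finset.sum_congr rfl fun l hl => ?_
  have hl := Finset.mem_range.mp hl
  have e : R + (R - 1 - l) = 2 * R - 1 - l := by omega
  rw [e, Nat.choose_symm (by omega), show 2 * R - 1 - (2 * R - 1 - l) = l by omega]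
  ring

theorem sum_range_sum_antidiagonal {M : Type*} [AddCommMonoid M] (f : ℕ → ℕ → M) (K : ℕ) :
    ∑ j ∈ Finset.range K, ∑ l ∈ Finset.range (K - j), f j l =
      ∑ ν ∈ Finset.range K, ∑ s ∈ Finset.HasAntidiagonal.antidiagonal ν, f s.1 s.2 := by
  simp_rw [Finset.sum_sigma']
  refine Finset.sum_nbij' (fun p => ⟨p.1 + p.2, (p.1, p.2)⟩) (fun p => ⟨p.2.1, p.2.2⟩) ?_ ?_ ?_ ?_ ?_
  · rintro ⟨j, l⟩ h
    simp only [Finset.mem_sigma, Finset.mem_range] at h ⊢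
    exact ⟨by omega, by simp⟩
  · rintro ⟨ν, j, l⟩ h
    simp only [Finset.mem_sigma, Finset.mem_range, Finset.HasAntidiagonal.mem_antidiagonal] at h ⊢
    omega
  · rintro ⟨j, l⟩ h
    rfl
  · rintro ⟨ν, j, l⟩ h
    simp only [Finset.mem_sigma, Finset.mem_range, Finset.HasAntidiagonal.mem_antidiagonal] at h
    obtain ⟨-, rfl⟩ := h
    rfl
  · rintro ⟨j, l⟩ h
    rfl

theorem mem_indefTriples_toFinset {D : ℕ} {p : ℤ × ℤ × ℤ} :
    p ∈ (indefTriples_finite D).toFinset ↔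
      p.2.1 ^ 2 - 4 * p.1 * p.2.2 = (D : ℤ) ∧ 0 < p.1 ∧ p.2.2 < 0 :=
  Set.Finite.mem_toFinset _

theorem sum_indefTriples_neg (D : ℕ) (f : ℤ → ℤ → ℤ → ℝ) :
    ∑ p ∈ (indefTriples_finite D).toFinset, f p.1 (-p.2.1) p.2.2 =
      ∑ p ∈ (indefTriples_finite D).toFinset, f p.1 p.2.1 p.2.2 := by
  refine Finset.sum_nbij' (fun p => (p.1, -p.2.1, p.2.2)) (fun p => (p.1, -p.2.1, p.2.2))
    ?_ ?_ ?_ ?_ ?_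
  · intro p hp
    rw [mem_indefTriples_toFinset] at hp ⊢
    simpa using hp
  · intro p hp
    rw [mem_indefTriples_toFinset] at hp ⊢
    simpa using hp
  all_goals intro p; simp

theorem sum_indefTriples_swap (D : ℕ) (f : ℤ → ℤ → ℤ → ℝ) :
    ∑ p ∈ (indefTriples_finite D).toFinset, f (-p.2.2) p.2.1 (-p.1) =
      ∑ p ∈ (indefTriples_finite D).toFinset, f p.1 p.2.1 p.2.2 := by
  refine Finset.sum_nbij' (fun p => (-p.2.2, p.2.1, -p.1)) (fun p => (-p.2.2, p.2.1, -p.1))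
    ?_ ?_ ?_ ?_ ?_
  · intro p
    simp only [mem_indefTriples_toFinset]
    rintro ⟨h1, h2, h3⟩
    exact ⟨by rw [← h1]; ring, by omega, by omega⟩
  · intro p
    simp only [mem_indefTriples_toFinset]
    rintro ⟨h1, h2, h3⟩
    exact ⟨by rw [← h1]; ring, by omega, by omega⟩
  all_goals intro p; simp

/-- A contribution to the coefficient is a decomposition D = b² + 4n together with a divisor a of n.
Setting c = -n/a gives exactly the forms of discriminant D with a > 0 > c, and n = -ac. -/
theorem cauchyProd_thetaDeriv_sigma (j l v D : ℕ) :
    cauchyProd (fun m => (m : ℝ) ^ j * thetaCoeff m)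
      (dilateFour fun n => (n : ℝ) ^ l * (ArithmeticFunction.sigma v n : ℝ)) D =
    ∑ p ∈ (indefTriples_finite D).toFinset,
      (p.2.1 : ℝ) ^ (2 * j) * (-(p.1 * p.2.2 : ℝ)) ^ l * (p.1 : ℝ) ^ v := by
  have h : ∀ q : ℕ × ℕ, (q.1 : ℝ) ^ j * thetaCoeff q.1 *
      dilateFour (fun n => (n : ℝ) ^ l * (ArithmeticFunction.sigma v n : ℝ)) q.2 =
      ∑ b ∈ (Finset.Icc (-(q.1 : ℤ)) q.1).filter (fun b => b ^ 2 = (q.1 : ℤ)),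
        ∑ a ∈ (if 4 ∣ q.2 then (q.2 / 4).divisors else ∅),
          (b : ℝ) ^ (2 * j) * ((q.2 / 4 : ℕ) : ℝ) ^ l * (a : ℝ) ^ v := by
    intro q
    have h1 : ∀ b ∈ (Finset.Icc (-(q.1 : ℤ)) q.1).filter (fun b => b ^ 2 = (q.1 : ℤ)),
        ∑ a ∈ (if 4 ∣ q.2 then (q.2 / 4).divisors else ∅),
          (b : ℝ) ^ (2 * j) * ((q.2 / 4 : ℕ) : ℝ) ^ l * (a : ℝ) ^ v =
        (q.1 : ℝ) ^ j *
          dilateFour (fun n => (n : ℝ) ^ l * (ArithmeticFunction.sigma v n : ℝ)) q.2 := by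
      intro b hb
      rw [mem_filter_sq_eq] at hb
      have hb' : (b : ℝ) ^ 2 = (q.1 : ℝ) := by exact_mod_cast hb
      rw [← Finset.mul_sum, pow_mul, hb', dilateFour]
      split_ifs with h4
      · rw [ArithmeticFunction.sigma_apply]
        push_cast
        ring
      · simp
    rw [Finset.sum_congr rfl h1, Finset.sum_const, nsmul_eq_mul, thetaCoeff]
    ring
  unfold cauchyProd
  rw [Finset.sum_congr rfl fun q _ => h q]
  simp_rw [Finset.sum_sigma']
  refine Finset.sum_nbij' (fun t => ((t.2.2 : ℤ), t.2.1, -(((t.1.2 / 4) / t.2.2 : ℕ) : ℤ)))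
    (fun p => ⟨((p.2.1 ^ 2).toNat, (4 * (p.1 * -p.2.2)).toNat), p.2.1, p.1.toNat⟩) ?_ ?_ ?_ ?_ ?_
  · rintro ⟨⟨m, n⟩, b, a⟩ ht
    simp only [Finset.mem_sigma, Finset.HasAntidiagonal.mem_antidiagonal, mem_filter_sq_eq] at ht
    obtain ⟨hD, hb, ha⟩ := ht
    split_ifs at ha with h4
    · obtain ⟨r, rfl⟩ := h4
      rw [Nat.mul_div_cancel_left _ (by norm_num), Nat.mem_divisors] at ha
      obtain ⟨⟨c, rfl⟩, h0⟩ := ha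
      have ha0 : 0 < a := Nat.pos_of_ne_zero fun h => h0 (by rw [h, zero_mul])
      have hc0 : 0 < c := Nat.pos_of_ne_zero fun h => h0 (by rw [h, mul_zero])
      rw [mem_indefTriples_toFinset]
      simp only [Nat.mul_div_cancel_left _ (show 0 < 4 by norm_num),
        Nat.mul_div_cancel_left _ ha0]
      refine ⟨?_, by omega, by omega⟩
      rw [hb, ← hD]
      push_cast
      ring
    · simp at ha
  · rintro ⟨a, b, c⟩ hp
    rw [mem_indefTriples_toFinset] at hp
    obtain ⟨h1, h2, h3⟩ := hp
    simp only at h1 h2 h3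
    lift a to ℕ using h2.le
    obtain ⟨c, rfl⟩ : ∃ c' : ℕ, c = -(c' : ℤ) := ⟨c.natAbs, by omega⟩
    have e : (4 * ((a : ℤ) * - -(c : ℤ))).toNat = 4 * (a * c) := by
      rw [neg_neg]; exact_mod_cast Int.toNat_natCast (4 * (a * c))
    simp only [Finset.mem_sigma, Finset.HasAntidiagonal.mem_antidiagonal, e, Nat.mul_div_cancel_left _ (show 0 < 4 by norm_num), Nat.mem_divisors, Int.toNat_natCast,
      dvd_mul_right, if_true, true_and, Int.toNat_of_nonneg (sq_nonneg b)]
    refine ⟨?_, ?_⟩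
    · zify
      rw [Int.toNat_of_nonneg (sq_nonneg b), ← h1]
      ring
    · refine ⟨Finset.mem_filter.mpr ⟨Finset.mem_Icc.mpr ⟨?_, ?_⟩, rfl⟩,
        (Nat.mul_pos (by omega : 0 < a) (by omega : 0 < c)).ne'⟩ <;>
      nlinarith [sq_nonneg (b - 1), sq_nonneg (b + 1)]
  · rintro ⟨⟨m, n⟩, b, a⟩ ht
    simp only [Finset.mem_sigma, Finset.HasAntidiagonal.mem_antidiagonal, mem_filter_sq_eq] at ht
    obtain ⟨hD, hb, ha⟩ := ht
    split_ifs at ha with h4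
    · obtain ⟨r, rfl⟩ := h4
      rw [Nat.mul_div_cancel_left _ (by norm_num), Nat.mem_divisors] at ha
      obtain ⟨⟨c, rfl⟩, h0⟩ := ha
      have ha0 : 0 < a := Nat.pos_of_ne_zero fun h => h0 (by rw [h, zero_mul])
      simp only [Nat.mul_div_cancel_left _ (show 0 < 4 by norm_num),
        Nat.mul_div_cancel_left _ ha0, hb, Int.toNat_natCast, neg_neg]
      have e : (4 * ((a : ℤ) * (c : ℤ))).toNat = 4 * (a * c) := by
        exact_mod_cast Int.toNat_natCast (4 * (a * c))
      rw [e]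
    · simp at ha
  · rintro ⟨a, b, c⟩ hp
    rw [mem_indefTriples_toFinset] at hp
    obtain ⟨h1, h2, h3⟩ := hp
    simp only at h1 h2 h3
    lift a to ℕ using h2.le
    obtain ⟨c, rfl⟩ : ∃ c' : ℕ, c = -(c' : ℤ) := ⟨c.natAbs, by omega⟩
    have e : (4 * ((a : ℤ) * - -(c : ℤ))).toNat = 4 * (a * c) := by
      rw [neg_neg]; exact_mod_cast Int.toNat_natCast (4 * (a * c))
    have ha0 : 0 < a := by omega
    simp only [e, Nat.mul_div_cancel_left _ (show 0 < 4 by norm_num), Int.toNat_natCast,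
      Nat.mul_div_cancel_left _ ha0]
  · rintro ⟨⟨m, n⟩, b, a⟩ ht
    simp only [Finset.mem_sigma, Finset.HasAntidiagonal.mem_antidiagonal, mem_filter_sq_eq] at ht
    obtain ⟨hD, hb, ha⟩ := ht
    split_ifs at ha with h4
    · obtain ⟨r, rfl⟩ := h4
      rw [Nat.mul_div_cancel_left _ (by norm_num), Nat.mem_divisors] at ha
      obtain ⟨⟨c, rfl⟩, h0⟩ := ha
      have ha0 : 0 < a := Nat.pos_of_ne_zero fun h => h0 (by rw [h, zero_mul])
      simp only [Nat.mul_div_cancel_left _ (show 0 < 4 by norm_num),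
        Nat.mul_div_cancel_left _ ha0]
      push_cast
      ring
    · simp at ha

/-- The positive-index coefficients of the Eisenstein series give the sum over forms. Its constant
term survives only undifferentiated, where it is -B_w/(2w) divided by (w - 1)!. -/
theorem cauchyProd_thetaDeriv_eisDeriv {w : ℕ} (hw : 1 ≤ w) (j l D : ℕ) :
    cauchyProd (thetaDeriv j) (dilateFour (eisDeriv w l)) D =
      (∑ p ∈ (indefTriples_finite D).toFinset,
        (p.2.1 : ℝ) ^ (2 * j) * (-(p.1 * p.2.2 : ℝ)) ^ l * (p.1 : ℝ) ^ (w - 1)) /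
          ((2 * j).factorial * l.factorial * (l + w - 1).factorial) -
      if l = 0 then thetaDeriv j D * (_root_.bernoulli w / (2 * w.factorial)) else 0 := by
  rw [← cauchyProd_thetaDeriv_sigma]
  have hterm : ∀ n, dilateFour (eisDeriv w l) n =
      dilateFour (fun n => (n : ℝ) ^ l * (ArithmeticFunction.sigma (w - 1) n : ℝ)) n /
        (l.factorial * (l + w - 1).factorial) -
      if n = 0 then (if l = 0 then (_root_.bernoulli w / (2 * w.factorial) : ℝ) else 0) else 0 := by
    intro n
    unfold dilateFour eisDeriv eisCoeff
    rcases Nat.eq_zero_or_pos n with rfl | hn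
    · have hwf : (w.factorial : ℝ) = w * (w - 1).factorial := by
        exact_mod_cast (Nat.mul_factorial_pred (by omega)).symm
      rcases Nat.eq_zero_or_pos l with rfl | hl
      · simp [hwf]
        have h0 : ((w - 1).factorial : ℝ) ≠ 0 := by positivity
        field_simp
      · simp [hl.ne']
    · rw [if_neg hn.ne']
      split_ifs with h4 h5
      · omega
      · ring
      · simp
  have hn : ∀ s : ℕ × ℕ, thetaDeriv j s.1 * dilateFour (eisDeriv w l) s.2 =
      ((s.1 : ℝ) ^ j * thetaCoeff s.1) *
        dilateFour (fun n => (n : ℝ) ^ l * (ArithmeticFunction.sigma (w - 1) n : ℝ)) s.2 /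
        ((2 * j).factorial * l.factorial * (l + w - 1).factorial) -
      if s.2 = 0 then thetaDeriv j s.1 *
        (if l = 0 then (_root_.bernoulli w / (2 * w.factorial) : ℝ) else 0) else 0 := by
    intro s
    rw [hterm, mul_sub]
    congr 1
    · rw [thetaDeriv]
      field_simp
    · split_ifs <;> simp
  unfold cauchyProd
  rw [Finset.sum_congr rfl fun s _ => hn s, Finset.sum_sub_distrib, ← Finset.sum_div]
  congr 1
  rw [Finset.sum_eq_single (D, 0)]
  · simp
  · intro s hs hne
    rw [if_neg]
    intro h0
    apply hne
    have := Finset.HasAntidiagonal.mem_antidiagonal.mp hs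
    ext <;> simp <;> omega
  · simp

/-- The alternating signs of the bracket cancel against those of (-ac)^l. -/
theorem bracketCoeff_eq {w : ℕ} (hw : 1 ≤ w) (ν D : ℕ) : bracketCoeff w ν D =
    ∑ s ∈ Finset.HasAntidiagonal.antidiagonal ν, (∑ p ∈ (indefTriples_finite D).toFinset,
        (p.2.1 : ℝ) ^ (2 * s.1) * (p.1 : ℝ) ^ (s.2 + w - 1) * (p.2.2 : ℝ) ^ s.2) /
          ((2 * s.1).factorial * s.2.factorial * (s.2 + w - 1).factorial) -
      thetaDeriv ν D * (_root_.bernoulli w / (2 * w.factorial)) +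
      (if w = 2 then 1 / 2 else 0) * thetaDeriv (ν + 1) D := by
  unfold bracketCoeff
  congr 1
  simp_rw [cauchyProd_thetaDeriv_eisDeriv hw, mul_sub]
  rw [Finset.sum_sub_distrib]
  congr 1
  · refine Finset.sum_congr rfl fun s _ => ?_
    rw [← mul_div_assoc, Finset.mul_sum]
    congr 1
    refine Finset.sum_congr rfl fun p _ => ?_
    rw [neg_pow (_ * _), show s.2 + w - 1 = s.2 + (w - 1) by omega, pow_add, mul_pow]
    have : ((-1 : ℝ) ^ s.2) * (-1) ^ s.2 = 1 := by rw [← mul_pow]; simp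
    linear_combination ((p.2.1 : ℝ) ^ (2 * s.1) * (p.1 : ℝ) ^ s.2 * (p.2.2 : ℝ) ^ s.2 *
      (p.1 : ℝ) ^ (w - 1)) * this
  · rw [Finset.sum_eq_single (ν, 0)]
    · simp
    · intro s hs hne
      rw [if_neg, mul_zero]
      intro h0
      apply hne
      have := Finset.HasAntidiagonal.mem_antidiagonal.mp hs
      ext <;> simp <;> omega
    · simp

/-- Expand in powers of bx and of ax² + c. Odd powers of b cancel under b ↦ -b. What remains is an
odd power of ax² + c, whose complementary terms are exchanged up to sign by (a, c) ↦ (-c, -a); this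
produces x^{2k-2-2ν} - x^{2ν} with k = 2K and ν = j + l. -/
theorem aeval_Pstar {K : ℕ} (hK : 0 < K) (D : ℕ) (x : ℝ) :
    Polynomial.aeval x (Pstar (2 * K) D) = ∑ ν ∈ Finset.range K,
      (x ^ (2 * (2 * K) - 2 - 2 * ν) - x ^ (2 * ν)) * ((2 * K - 1).factorial *
      ∑ s ∈ Finset.HasAntidiagonal.antidiagonal ν, (∑ p ∈ (indefTriples_finite D).toFinset,
        (p.2.1 : ℝ) ^ (2 * s.1) * (p.1 : ℝ) ^ (s.2 + (2 * K - 2 * ν) - 1) * (p.2.2 : ℝ) ^ s.2) /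
          ((2 * s.1).factorial * s.2.factorial * (s.2 + (2 * K - 2 * ν) - 1).factorial)) := by
  set T := (indefTriples_finite D).toFinset with hT
  have hodd : ∀ j, ∑ p ∈ T, ((p.2.1 : ℝ) * x) ^ (2 * j + 1) *
      (p.1 * x ^ 2 + p.2.2) ^ (2 * K - 1 - (2 * j + 1)) * (2 * K - 1).choose (2 * j + 1) = 0 := by
    intro j
    have h := sum_indefTriples_neg D fun a b c => ((b : ℝ) * x) ^ (2 * j + 1) *
      (a * x ^ 2 + c) ^ (2 * K - 1 - (2 * j + 1)) * (2 * K - 1).choose (2 * j + 1)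
    simp only [Int.cast_neg, neg_mul, Odd.neg_pow (show Odd (2 * j + 1) from ⟨j, rfl⟩),
      Finset.sum_neg_distrib] at h
    rw [← hT] at h
    linarith
  have hev : ∀ j ∈ Finset.range K, ∑ p ∈ T, ((p.2.1 : ℝ) * x) ^ (2 * j) *
      (p.1 * x ^ 2 + p.2.2) ^ (2 * K - 1 - 2 * j) * (2 * K - 1).choose (2 * j) =
      ∑ l ∈ Finset.range (K - j), (x ^ (2 * (2 * K) - 2 - 2 * (j + l)) - x ^ (2 * (j + l))) *
        ((2 * K - 1).factorial * ((∑ p ∈ T, (p.2.1 : ℝ) ^ (2 * j) *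
          (p.1 : ℝ) ^ (l + (2 * K - 2 * (j + l)) - 1) * (p.2.2 : ℝ) ^ l) /
          ((2 * j).factorial * l.factorial * (l + (2 * K - 2 * (j + l)) - 1).factorial))) := by
    intro j hj
    have hj := Finset.mem_range.mp hj
    have hexp : 2 * K - 1 - 2 * j = 2 * (K - j) - 1 := by omega
    simp_rw [hexp, add_pow_odd _ _ (Nat.sub_pos_of_lt hj), Finset.mul_sum, Finset.sum_mul]
    rw [Finset.sum_comm]
    refine Finset.sum_congr rfl fun l hl => ?_
    have hl := Finset.mem_range.mp hl
    obtain ⟨r, hr⟩ : ∃ r, r = l + (2 * K - 2 * (j + l)) - 1 := ⟨_, rfl⟩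
    have e1 : 2 * (K - j) - 1 - l = r := by omega
    have e2 : 2 * (2 * K) - 2 - 2 * (j + l) = 2 * j + 2 * r := by omega
    rw [← hr, e1, e2]
    have hswap : ∑ p ∈ T, (p.2.1 : ℝ) ^ (2 * j) * (p.1 : ℝ) ^ l * (p.2.2 : ℝ) ^ r =
        -∑ p ∈ T, (p.2.1 : ℝ) ^ (2 * j) * (p.1 : ℝ) ^ r * (p.2.2 : ℝ) ^ l := by
      rw [hT, ← sum_indefTriples_swap D fun a b c => (b : ℝ) ^ (2 * j) * (a : ℝ) ^ l * (c : ℝ) ^ r,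
        ← Finset.sum_neg_distrib]
      refine Finset.sum_congr rfl fun p _ => ?_
      -- The exponents l and r are complementary in the odd number 2(K - j) - 1, whence the minus
      -- sign.
      have hneg : (-1 : ℝ) ^ l * (-1) ^ r = -1 := by
        rw [← pow_add]
        exact Odd.neg_one_pow ⟨K - j - 1, by omega⟩
      push_cast
      rw [neg_pow (p.2.2 : ℝ), neg_pow (p.1 : ℝ)]
      linear_combination ((p.2.1 : ℝ) ^ (2 * j) * (p.1 : ℝ) ^ r * (p.2.2 : ℝ) ^ l) * hneg
    have hchoose : ((2 * K - 1).choose (2 * j) * (2 * (K - j) - 1).choose l : ℝ) =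
        (2 * K - 1).factorial / ((2 * j).factorial * l.factorial * r.factorial) := by
      rw [Nat.cast_choose ℝ (show 2 * j ≤ 2 * K - 1 by omega),
        Nat.cast_choose ℝ (show l ≤ 2 * (K - j) - 1 by omega), e1, hexp]
      field_simp
    calc _ = ((2 * K - 1).choose (2 * j) * (2 * (K - j) - 1).choose l : ℝ) *
          (x ^ (2 * j + 2 * r) * ∑ p ∈ T, (p.2.1 : ℝ) ^ (2 * j) * (p.1 : ℝ) ^ r * (p.2.2 : ℝ) ^ l +
          x ^ (2 * (j + l)) *
            ∑ p ∈ T, (p.2.1 : ℝ) ^ (2 * j) * (p.1 : ℝ) ^ l * (p.2.2 : ℝ) ^ r) := by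
          rw [Finset.mul_sum, Finset.mul_sum, ← Finset.sum_add_distrib, Finset.mul_sum]
          refine Finset.sum_congr rfl fun p _ => ?_
          rw [mul_pow, mul_pow, mul_pow, ← pow_mul, ← pow_mul, mul_add 2 j l, pow_add, pow_add]
          ring
      _ = _ := by
          rw [hswap, hchoose]
          ring
  have hmain : Polynomial.aeval x (Pstar (2 * K) D) = ∑ j ∈ Finset.range (2 * K),
      ∑ p ∈ T, ((p.2.1 : ℝ) * x) ^ j * (p.1 * x ^ 2 + p.2.2) ^ (2 * K - 1 - j) *
        (2 * K - 1).choose j := by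
    rw [Pstar, map_sum, Finset.sum_comm]
    refine Finset.sum_congr rfl fun p _ => ?_
    have h := add_pow ((p.2.1 : ℝ) * x) (p.1 * x ^ 2 + p.2.2) (2 * K - 1)
    rw [show 2 * K - 1 + 1 = 2 * K by omega] at h
    rw [← h]
    simp
    ring
  rw [hmain, sum_range_two_mul]
  simp_rw [hodd, add_zero]
  rw [Finset.sum_congr rfl hev, sum_range_sum_antidiagonal fun j l =>
    (x ^ (2 * (2 * K) - 2 - 2 * (j + l)) - x ^ (2 * (j + l))) *
        ((2 * K - 1).factorial * ((∑ p ∈ T, (p.2.1 : ℝ) ^ (2 * j) *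
          (p.1 : ℝ) ^ (l + (2 * K - 2 * (j + l)) - 1) * (p.2.2 : ℝ) ^ l) /
          ((2 * j).factorial * l.factorial * (l + (2 * K - 2 * (j + l)) - 1).factorial)))]
  refine Finset.sum_congr rfl fun ν _ => ?_
  rw [Finset.mul_sum, Finset.mul_sum]
  refine Finset.sum_congr rfl fun s hs => ?_
  rw [Finset.HasAntidiagonal.mem_antidiagonal.mp hs]

theorem natDegree_bernoulli_lt (k : ℕ) : (Polynomial.bernoulli k).natDegree < k + 1 := by
  refine Nat.lt_succ_of_le ?_
  rw [Polynomial.bernoulli]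
  refine Polynomial.natDegree_sum_le_of_forall_le _ _ fun i hi => ?_
  refine (Polynomial.natDegree_monomial_le _).trans ?_
  omega

/-- The coefficient of index j multiplies x^j - x^{2k-2-j} with k = 2K. Even j < k give the terms ν
= j/2, and j = k gives minus the difference belonging to ν = K - 1, hence the extra m^k there. -/
theorem aeval_bernoulli_comp_sub_bernoulliInv {K : ℕ} (hK : 0 < K) (m : ℕ) (x : ℝ) :
    Polynomial.aeval x ((Polynomial.bernoulli (2 * K)).comp (Polynomial.C (m : ℚ) * Polynomial.X) -
      bernoulliInv (2 * K) m) = ∑ ν ∈ Finset.range K,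
      (x ^ (2 * (2 * K) - 2 - 2 * ν) - x ^ (2 * ν)) *
      (-((2 * K).choose (2 * ν) * _root_.bernoulli (2 * K - 2 * ν) * (m : ℝ) ^ (2 * ν)) +
        if ν + 1 = K then (m : ℝ) ^ (2 * K) else 0) := by
  have h1 : Polynomial.aeval x ((Polynomial.bernoulli (2 * K)).comp
      (Polynomial.C (m : ℚ) * Polynomial.X) - bernoulliInv (2 * K) m) =
      ∑ j ∈ Finset.range (2 * K + 1), ((2 * K).choose j * _root_.bernoulli (2 * K - j) *
        (m : ℝ) ^ j) * (x ^ j - x ^ (2 * (2 * K) - 2 - j)) := by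
    rw [map_sub, Polynomial.aeval_comp,
      Polynomial.aeval_eq_sum_range' (natDegree_bernoulli_lt (2 * K)), bernoulliInv, map_sum,
      ← Finset.sum_sub_distrib]
    refine Finset.sum_congr rfl fun j hj => ?_
    have hj := Finset.mem_range.mp hj
    rw [Polynomial.coeff_bernoulli, if_pos (by omega)]
    simp [Algebra.smul_def]
    ring
  rw [h1, Finset.sum_range_succ, sum_range_two_mul]
  have h2 : ∀ ν ∈ Finset.range K, ((2 * K).choose (2 * ν + 1) *
      _root_.bernoulli (2 * K - (2 * ν + 1)) * (m : ℝ) ^ (2 * ν + 1)) *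
      (x ^ (2 * ν + 1) - x ^ (2 * (2 * K) - 2 - (2 * ν + 1))) = 0 := by
    intro ν hν
    have hν := Finset.mem_range.mp hν
    -- For j = k - 1 the number B₁ does not vanish, but the two powers of x coincide; for smaller
    -- odd j the Bernoulli number is zero.
    rcases eq_or_ne (ν + 1) K with rfl | h
    · rw [show 2 * (2 * (ν + 1)) - 2 - (2 * ν + 1) = 2 * ν + 1 by omega]
      ring
    · rw [bernoulli_eq_zero_of_odd ⟨K - ν - 1, by omega⟩ (by omega)]
      simp
  rw [Finset.sum_congr rfl fun ν hν => by rw [h2 ν hν, add_zero]]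
  simp_rw [mul_add, Finset.sum_add_distrib]
  congr 1
  · refine Finset.sum_congr rfl fun ν _ => ?_
    ring
  · rw [Finset.sum_eq_single (K - 1)]
    · rw [if_pos (by omega), show 2 * (2 * K) - 2 - 2 * (K - 1) = 2 * K by omega,
        show 2 * (2 * K) - 2 - 2 * K = 2 * (K - 1) by omega]
      simp
      ring
    · intro ν _ hne
      rw [if_neg (by omega), mul_zero]
    · intro h
      exact absurd (Finset.mem_range.mpr (by omega)) h

/-- The sums over forms agree by `aeval_Pstar`. The Bernoulli terms match the constant terms of the
Eisenstein series, and the extra m^k/k at ν = K - 1 matches the correction in weight 2. Squares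
enter because the coefficients of θ live on them. -/
theorem aeval_P_eq {K : ℕ} (hK : 0 < K) (D : ℕ) (x : ℝ) :
    Polynomial.aeval x (P (2 * K) D) = ∑ ν ∈ Finset.range K,
      (x ^ (2 * (2 * K) - 2 - 2 * ν) - x ^ (2 * ν)) *
        ((2 * K - 1).factorial * bracketCoeff (2 * K - 2 * ν) ν D) := by
  have hfac : ((2 * K).factorial : ℝ) = 2 * K * (2 * K - 1).factorial := by
    exact_mod_cast (Nat.mul_factorial_pred (by omega : 2 * K ≠ 0)).symm
  have hK0 : (K : ℝ) ≠ 0 := by exact_mod_cast hK.ne'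
  have hf0 : ((2 * K - 1).factorial : ℝ) ≠ 0 := by positivity
  have hrhs : ∑ ν ∈ Finset.range K, (x ^ (2 * (2 * K) - 2 - 2 * ν) - x ^ (2 * ν)) *
        ((2 * K - 1).factorial * bracketCoeff (2 * K - 2 * ν) ν D) =
      Polynomial.aeval x (Pstar (2 * K) D) +
      ∑ ν ∈ Finset.range K, (x ^ (2 * (2 * K) - 2 - 2 * ν) - x ^ (2 * ν)) *
        ((2 * K - 1).factorial * (-(thetaDeriv ν D *
          (_root_.bernoulli (2 * K - 2 * ν) / (2 * (2 * K - 2 * ν).factorial))) +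
          (if ν + 1 = K then 1 / 2 else 0) * thetaDeriv (ν + 1) D)) := by
    rw [aeval_Pstar hK, ← Finset.sum_add_distrib]
    refine Finset.sum_congr rfl fun ν hν => ?_
    have hν := Finset.mem_range.mp hν
    rw [bracketCoeff_eq (by omega)]
    have : (2 * K - 2 * ν = 2) ↔ (ν + 1 = K) := by omega
    simp only [this]
    ring
  rw [hrhs, P]
  split_ifs with h0 hsq
  · subst h0
    have hP : Pstar (2 * K) 0 = 0 := by
      rw [Pstar]
      refine Finset.sum_eq_zero fun p hp => ?_
      rw [mem_indefTriples_toFinset] at hp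
      obtain ⟨h1, h2, h3⟩ := hp
      have := mul_pos h2 (neg_pos.mpr h3)
      push_cast at h1
      nlinarith [sq_nonneg p.2.1]
    rw [hP, map_zero, zero_add, Finset.sum_eq_single 0]
    · have h00 : thetaDeriv 0 0 = 1 := by simp [thetaDeriv, thetaCoeff_zero]
      have h01 : thetaDeriv (0 + 1) 0 = 0 := by simp [thetaDeriv]
      rw [h00, h01, mul_zero 2, Nat.sub_zero, Nat.sub_zero, hfac]
      simp
      field_simp
      ring
    · intro ν _ hne
      simp [thetaDeriv, hne]
    · intro h
      exact absurd (Finset.mem_range.mpr hK) h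
  · obtain ⟨m, hm⟩ := hsq
    have hm0 : m ≠ 0 := by rintro rfl; exact h0 (by simpa using hm)
    rw [← pow_two] at hm
    subst hm
    rw [map_add, map_mul, pow_two, Nat.sqrt_eq, aeval_bernoulli_comp_sub_bernoulliInv hK,
      ← pow_two, Finset.mul_sum]
    congr 1
    refine Finset.sum_congr rfl fun ν hν => ?_
    have hν := Finset.mem_range.mp hν
    have ht : ∀ j, thetaDeriv j (m ^ 2) = 2 * m ^ (2 * j) / (2 * j).factorial := by
      intro j
      rw [thetaDeriv, thetaCoeff_sq hm0]
      push_cast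
      ring
    rw [ht, ht, Nat.cast_choose ℝ (show 2 * ν ≤ 2 * K by omega), hfac, mul_left_comm]
    congr 1
    rw [Polynomial.aeval_C, mul_add, mul_add]
    have hf1 : ((2 * ν).factorial : ℝ) ≠ 0 := by positivity
    have hf2 : ((2 * K - 2 * ν).factorial : ℝ) ≠ 0 := by positivity
    congr 1
    · simp
      field_simp
    · split_ifs with h
      · rw [h, hfac]
        simp
        field_simp
      · simp
  · have ht : ∀ j, thetaDeriv j D = 0 := fun j => by
      rw [thetaDeriv, thetaCoeff_of_not_isSquare hsq]; simp
    simp [ht]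

theorem modularCoeff_aeval_P {k : ℕ} (hk : 0 < k) (hk2 : Even k) (x : ℝ) :
    ModularCoeff k fun D => Polynomial.aeval x (P k D) := by
  obtain ⟨K, rfl⟩ := hk2.two_dvd
  have hK : 0 < K := by omega
  simp_rw [aeval_P_eq hK]
  refine ModularCoeff.sum _ fun ν hν => ?_
  have hν := Finset.mem_range.mp hν
  have h := modularCoeff_bracketCoeff (w := 2 * K - 2 * ν) (by omega) ⟨K - ν, by omega⟩ ν
  rw [show 2 * K - 2 * ν + 2 * ν = 2 * K by omega] at h
  exact (h.smul _).smul _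

/-! ### The functional equations of `F_{k,D}` -/

/-- The value `ax² + bx + c`. -/
def formEval (p : ℤ × ℤ × ℤ) (x : ℝ) : ℝ := (p.1 : ℝ) * x ^ 2 + (p.2.1 : ℝ) * x + (p.2.2 : ℝ)

/-- For x = r/s, the integer n = s²(ax² + bx + c) is positive, and Ds² = (2ar + bs)² + 4(-a)n bounds
both a and 2ar + bs. These two determine b, and then the discriminant determines c since a ≠ 0. -/
theorem coneTriples_finite (D : ℕ) (x : ℚ) : (coneTriples D x).Finite := by
  set s : ℤ := (x.den : ℤ) with hs
  set r : ℤ := x.num with hr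
  have hs0 : 0 < s := Int.natCast_pos.mpr x.den_pos
  have hs0' : (s : ℝ) ≠ 0 := by exact_mod_cast hs0.ne'
  have hx : (x : ℝ) = r / s := by
    rw [hs, hr]; exact_mod_cast (Rat.num_div_den x).symm
  refine Set.Finite.of_injOn (f := fun p : ℤ × ℤ × ℤ => (p.1, 2 * p.1 * r + p.2.1 * s))
    (t := Set.Icc (-(D * s ^ 2)) (D * s ^ 2) ×ˢ Set.Icc (-(D * s ^ 2)) (D * s ^ 2)) ?_ ?_
    ((Set.finite_Icc _ _).prod (Set.finite_Icc _ _))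
  · rintro ⟨a, b, c⟩ ⟨h1, h2, h3⟩
    simp only at h1 h2 h3
    have hn : 0 < a * r ^ 2 + b * r * s + c * s ^ 2 := by
      have h : ((a * r ^ 2 + b * r * s + c * s ^ 2 : ℤ) : ℝ) =
          s ^ 2 * (a * (x : ℝ) ^ 2 + b * x + c) := by
        rw [hx]; push_cast; field_simp
      have h' : (0 : ℝ) < ((a * r ^ 2 + b * r * s + c * s ^ 2 : ℤ) : ℝ) := by
        rw [h]; exact mul_pos (by positivity) h2
      exact_mod_cast h'
    set n := a * r ^ 2 + b * r * s + c * s ^ 2 with hn_def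
    have hkey : D * s ^ 2 = (2 * a * r + b * s) ^ 2 + 4 * (-a) * n := by rw [← h1, hn_def]; ring
    have han : -a ≤ -a * n := by nlinarith
    have hsq := Int.le_self_sq (2 * a * r + b * s)
    have hsq' := Int.le_self_sq (-(2 * a * r + b * s))
    rw [neg_sq] at hsq'
    simp only [Set.mem_prod, Set.mem_Icc]
    have h0 := sq_nonneg (2 * a * r + b * s)
    refine ⟨⟨?_, ?_⟩, ?_, ?_⟩ <;> linarith
  · rintro ⟨a, b, c⟩ ⟨h1, h2, h3⟩ ⟨a', b', c'⟩ ⟨h1', h2', h3'⟩ h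
    simp only [Prod.mk.injEq] at h h1 h1' h3 ⊢
    obtain ⟨rfl, h⟩ := h
    have hb : b = b' := mul_right_cancel₀ hs0.ne' (add_left_cancel h)
    subst hb
    refine ⟨rfl, rfl, mul_left_cancel₀ (show 4 * a ≠ 0 by omega) ?_⟩
    linarith

theorem Fstar_eq_sum (k D : ℕ) (x : ℚ) : Fstar k D x =
    ∑ p ∈ (coneTriples_finite D x).toFinset, formEval p x ^ (k - 1) := by
  rw [← Finset.tsum_subtype', Fstar, Set.Finite.coe_toFinset]
  rfl

theorem mem_coneTriples_toFinset {D : ℕ} {x : ℚ} {p : ℤ × ℤ × ℤ} :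
    p ∈ (coneTriples_finite D x).toFinset ↔
      p.2.1 ^ 2 - 4 * p.1 * p.2.2 = (D : ℤ) ∧ 0 < formEval p x ∧ p.1 < 0 :=
  Set.Finite.mem_toFinset _

theorem formEval_swap (p : ℤ × ℤ × ℤ) {x : ℝ} (hx : x ≠ 0) :
    x ^ 2 * formEval (p.2.2, p.2.1, p.1) x⁻¹ = formEval p x := by
  simp only [formEval]
  field_simp
  ring

theorem aeval_Pstar_eq_sum (k D : ℕ) (x : ℝ) : Polynomial.aeval x (Pstar k D) =
    ∑ p ∈ (indefTriples_finite D).toFinset, formEval p x ^ (k - 1) := by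
  rw [Pstar, map_sum]
  refine Finset.sum_congr rfl fun p _ => ?_
  simp [formEval]

/-- Outside the common part of A and V there remain forms with a < 0 ≤ c and forms with c < 0 ≤ a.
Negating those with a < 0 < c gives the forms a > 0 > c that are negative at x; since n is odd, they
complete the sum over all forms with a > 0 > c. The degenerate forms c = 0 or a = 0 are kept apart.
-/
theorem sum_sub_sum_eq_neg_Pstar {n D : ℕ} (hn : Odd n) (x : ℝ) {A V : Finset (ℤ × ℤ × ℤ)}
    (hA : ∀ p, p ∈ A ↔ p.2.1 ^ 2 - 4 * p.1 * p.2.2 = (D : ℤ) ∧ 0 < formEval p x ∧ p.1 < 0)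
    (hV : ∀ p, p ∈ V ↔ p.2.1 ^ 2 - 4 * p.1 * p.2.2 = (D : ℤ) ∧ 0 < formEval p x ∧ p.2.2 < 0) :
    ∑ p ∈ A, formEval p x ^ n - ∑ p ∈ V, formEval p x ^ n =
      -∑ p ∈ (indefTriples_finite D).toFinset, formEval p x ^ n +
      ∑ p ∈ A.filter (fun p => p.2.2 = 0), formEval p x ^ n -
      ∑ p ∈ V.filter (fun p => p.1 = 0), formEval p x ^ n := by
  classical
  set T := (indefTriples_finite D).toFinset with hT
  have h1 : ∑ p ∈ A \ V, formEval p x ^ n = ∑ p ∈ A.filter (fun p => p.2.2 = 0), formEval p x ^ n +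
      ∑ p ∈ A.filter (fun p => 0 < p.2.2), formEval p x ^ n := by
    rw [← Finset.sum_filter_add_sum_filter_not (A \ V) (fun p => p.2.2 = 0)]
    congr 2
    · ext p
      simp only [Finset.mem_filter, Finset.mem_sdiff, hA, hV]
      constructor
      · tauto
      · rintro ⟨h, h0⟩
        exact ⟨⟨h, by omega⟩, h0⟩
    · ext p
      simp only [Finset.mem_filter, Finset.mem_sdiff, hA, hV]
      constructor
      · rintro ⟨⟨h, h0⟩, h3⟩
        refine ⟨h, ?_⟩
        by_contra h4
        exact h0 ⟨h.1, h.2.1, by omega⟩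
      · rintro ⟨h, h0⟩
        exact ⟨⟨h, by omega⟩, by omega⟩
  have h2 : ∑ p ∈ V \ A, formEval p x ^ n = ∑ p ∈ V.filter (fun p => p.1 = 0), formEval p x ^ n +
      ∑ p ∈ T.filter (fun p => 0 < formEval p x), formEval p x ^ n := by
    rw [← Finset.sum_filter_add_sum_filter_not (V \ A) (fun p => p.1 = 0)]
    congr 2
    · ext p
      simp only [Finset.mem_filter, Finset.mem_sdiff, hA, hV]
      constructor
      · tauto
      · rintro ⟨h, h0⟩
        exact ⟨⟨h, by omega⟩, h0⟩
    · ext p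
      simp only [Finset.mem_filter, Finset.mem_sdiff, hA, hV, hT, mem_indefTriples_toFinset]
      constructor
      · rintro ⟨⟨h, h0⟩, h3⟩
        refine ⟨⟨h.1, ?_, h.2.2⟩, h.2.1⟩
        by_contra h4
        exact h0 ⟨h.1, h.2.1, by omega⟩
      · rintro ⟨h, h0⟩
        exact ⟨⟨⟨h.1, h0, h.2.2⟩, by omega⟩, by omega⟩
  have h3 : ∑ p ∈ T.filter (fun p => ¬ 0 < formEval p x), formEval p x ^ n =
      -∑ p ∈ A.filter (fun p => 0 < p.2.2), formEval p x ^ n := by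
    have hneg : ∀ p : ℤ × ℤ × ℤ, formEval (-p) x = -formEval p x := fun p => by
      simp only [formEval, Prod.fst_neg, Prod.snd_neg]
      push_cast
      ring
    -- Forms vanishing at x contribute nothing; dropping them makes negation a bijection onto forms
    -- that are strictly positive at x.
    rw [← Finset.sum_filter_of_ne (p := fun p => formEval p x ≠ 0), ← Finset.sum_neg_distrib]
    · refine Finset.sum_nbij' (fun p => -p) (fun p => -p) ?_ ?_ ?_ ?_ ?_
      · intro p
        simp only [Finset.mem_filter, hA, hT, mem_indefTriples_toFinset, hneg, Prod.fst_neg,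
          Prod.snd_neg]
        rintro ⟨⟨⟨h1, h2, h3⟩, h4⟩, h5⟩
        refine ⟨⟨by rw [← h1]; ring, ?_, by omega⟩, by omega⟩
        rcases lt_or_gt_of_ne h5 with h | h
        · linarith
        · exact absurd h h4
      · intro p
        simp only [Finset.mem_filter, hA, hT, mem_indefTriples_toFinset, hneg, Prod.fst_neg,
          Prod.snd_neg]
        rintro ⟨⟨h1, h2, h3⟩, h4⟩
        exact ⟨⟨⟨by rw [← h1]; ring, by omega, by omega⟩, by linarith⟩, by linarith⟩
      · intro p _; simp
      · intro p _; simp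
      · intro p _
        rw [hneg, hn.neg_pow, neg_neg]
    · intro p _ h h0
      rw [h0, zero_pow hn.pos.ne'] at h
      exact h rfl
  have h4 := Finset.sum_filter_add_sum_filter_not T (fun p => 0 < formEval p x)
    (fun p => formEval p x ^ n)
  have h5 := Finset.sum_sdiff_sub_sum_sdiff (s₁ := V) (s₂ := A) (f := fun p => formEval p x ^ n)
  linarith

/-- This iterates B_k(X + 1) - B_k(X) = kX^{k-1}. It converts the degenerate forms into the
difference between B_k and its periodic version. -/
theorem aeval_bernoulli_sub_natCast {k : ℕ} (y : ℝ) (N : ℕ) :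
    Polynomial.aeval y (Polynomial.bernoulli k) =
      Polynomial.aeval (y - N) (Polynomial.bernoulli k) +
        k * ∑ n ∈ Finset.range N, (y - (n + 1)) ^ (k - 1) := by
  induction N with
  | zero => simp
  | succ N ih =>
    have h := congrArg (Polynomial.aeval (y - (N + 1))) (Polynomial.bernoulli_comp_one_add_X k)
    rw [Polynomial.aeval_comp] at h
    simp only [map_add, map_one, Polynomial.aeval_X, nsmul_eq_mul, map_mul, map_natCast,
      map_pow] at h
    rw [show 1 + (y - (N + 1)) = y - N by ring] at h
    rw [ih, h, Finset.sum_range_succ]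
    push_cast
    ring

theorem bernoulliBar_eq {k : ℕ} {y : ℝ} (hy : 0 ≤ y) : bernoulliBar k y =
    Polynomial.aeval y (Polynomial.bernoulli k) -
      k * ∑ n ∈ Finset.range ⌊y⌋₊, (y - (n + 1)) ^ (k - 1) := by
  rw [aeval_bernoulli_sub_natCast y ⌊y⌋₊, bernoulliBar, natCast_floor_eq_intCast_floor hy]
  ring

/-- When y is an integer the last summand is zero, so the strict positivity demanded of forms costs
nothing. -/
theorem sum_range_floor_eq_sum_filter {y : ℝ} (hy : 0 ≤ y) {n : ℕ} (hn : n ≠ 0) :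
    ∑ i ∈ Finset.range ⌊y⌋₊, (y - (i + 1)) ^ n =
      ∑ i ∈ (Finset.range ⌊y⌋₊).filter (fun i : ℕ => (i : ℝ) + 1 < y), (y - (i + 1)) ^ n := by
  refine (Finset.sum_filter_of_ne fun i hi h => ?_).symm
  have h1 : ((i + 1 : ℕ) : ℝ) ≤ y :=
    (Nat.le_floor_iff hy).mp (Nat.succ_le_of_lt (Finset.mem_range.mp hi))
  push_cast at h1
  refine lt_of_le_of_ne h1 fun h2 => h ?_
  rw [h2, sub_self, zero_pow hn]

theorem mem_filter_range_floor {y : ℝ} (hy : 0 ≤ y) {i : ℕ} :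
    i ∈ (Finset.range ⌊y⌋₊).filter (fun i : ℕ => (i : ℝ) + 1 < y) ↔ (i : ℝ) + 1 < y := by
  rw [Finset.mem_filter, Finset.mem_range, and_iff_right_iff_imp]
  intro h
  refine Nat.lt_of_succ_le ((Nat.le_floor_iff hy).mpr ?_)
  push_cast
  exact h.le

/-- For a = 0 the discriminant forces b = ±m. The sign is positive because bx + c > 0 > c and x > 0,
so c is the only free parameter. -/
theorem sum_filter_fst_eq_zero {n m : ℕ} (hn : n ≠ 0) {x : ℝ} (hx : 0 < x)
    {V : Finset (ℤ × ℤ × ℤ)} (hV : ∀ p, p ∈ V ↔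
      p.2.1 ^ 2 - 4 * p.1 * p.2.2 = ((m ^ 2 : ℕ) : ℤ) ∧ 0 < formEval p x ∧ p.2.2 < 0) :
    ∑ p ∈ V.filter (fun p => p.1 = 0), formEval p x ^ n =
      ∑ i ∈ Finset.range ⌊m * x⌋₊, (m * x - (i + 1)) ^ n := by
  have hy : 0 ≤ m * x := by positivity
  rw [sum_range_floor_eq_sum_filter hy hn]
  refine Finset.sum_nbij' (fun p => (-p.2.2 - 1).toNat) (fun i => (0, (m : ℤ), -((i : ℤ) + 1)))
    ?_ ?_ ?_ ?_ ?_
  all_goals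
    first
    | rintro ⟨a, b, c⟩ hp
      simp only [Finset.mem_filter, hV, formEval] at hp
      obtain ⟨⟨h1, h2, h3⟩, rfl⟩ := hp
      obtain ⟨i, rfl⟩ : ∃ i : ℕ, c = -((i : ℤ) + 1) := ⟨(-c - 1).toNat, by omega⟩
      have hi : (- -((i : ℤ) + 1) - 1).toNat = i := by omega
      have hb : b = m := by
        push_cast at h1 h2
        have hb0 : (0 : ℝ) < b := by
          by_contra hb
          have : (b : ℝ) * x ≤ 0 := mul_nonpos_of_nonpos_of_nonneg (not_lt.mp hb) hx.le
          have : (0 : ℝ) ≤ i := i.cast_nonneg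
          linarith
        have hb1 : 0 < b := by exact_mod_cast hb0
        refine (pow_left_inj₀ hb1.le (Int.natCast_nonneg m) two_ne_zero).mp ?_
        linarith
      subst hb
      first
      | rw [mem_filter_range_floor hy]
        simp only [hi]
        push_cast at h2
        linarith
      | (simp only [hi]; done)
      | simp only [hi, formEval]
        push_cast
        congr 1
        ring
    | intro i hi
      rw [mem_filter_range_floor hy] at hi
      first
      | simp only [Finset.mem_filter, hV, formEval]
        push_cast
        refine ⟨⟨by ring, by linarith, by omega⟩, trivial⟩
      | simp

theorem sum_filter_snd_snd_eq_zero {n m : ℕ} (hn : n ≠ 0) {x : ℝ} (hx : 0 < x)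
    {A : Finset (ℤ × ℤ × ℤ)} (hA : ∀ p, p ∈ A ↔
      p.2.1 ^ 2 - 4 * p.1 * p.2.2 = ((m ^ 2 : ℕ) : ℤ) ∧ 0 < formEval p x ∧ p.1 < 0) :
    ∑ p ∈ A.filter (fun p => p.2.2 = 0), formEval p x ^ n =
      x ^ (2 * n) * ∑ i ∈ Finset.range ⌊m * x⁻¹⌋₊, (m * x⁻¹ - (i + 1)) ^ n := by
  have hinj : Function.Injective fun p : ℤ × ℤ × ℤ => (p.2.2, p.2.1, p.1) := by
    rintro ⟨a, b, c⟩ ⟨a', b', c'⟩ h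
    simp only [Prod.mk.injEq] at h ⊢
    tauto
  have hx0 : 0 < x⁻¹ := inv_pos.mpr hx
  rw [← sum_filter_fst_eq_zero (V := A.map ⟨_, hinj⟩) hn hx0, Finset.mul_sum]
  · refine Finset.sum_nbij' (fun p : ℤ × ℤ × ℤ => (p.2.2, p.2.1, p.1))
      (fun p => (p.2.2, p.2.1, p.1)) ?_ ?_ ?_ ?_ ?_
    · intro p hp
      simp only [Finset.mem_filter, Finset.mem_map] at hp ⊢
      exact ⟨⟨p, hp.1, rfl⟩, hp.2⟩
    · rintro p hp
      simp only [Finset.mem_filter, Finset.mem_map] at hp ⊢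
      obtain ⟨⟨q, hq, rfl⟩, h⟩ := hp
      exact ⟨hq, h⟩
    · intro p _; rfl
    · intro p _; rfl
    · intro p _
      rw [← formEval_swap p hx.ne', mul_pow, ← pow_mul]
  · rintro ⟨a, b, c⟩
    simp only [Finset.mem_map, Function.Embedding.coeFn_mk]
    have hsw := formEval_swap (c, b, a) hx.ne'
    simp only at hsw
    constructor
    · rintro ⟨q, hq, h⟩
      rw [hA] at hq
      obtain ⟨rfl, rfl, rfl⟩ : q.2.2 = a ∧ q.2.1 = b ∧ q.1 = c := by simpa using h
      refine ⟨by rw [← hq.1]; ring, ?_, hq.2.2⟩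
      have h1 := hq.2.1
      rw [← formEval_swap q hx.ne'] at h1
      exact pos_of_mul_pos_right h1 (by positivity)
    · rintro ⟨h1, h2, h3⟩
      refine ⟨(c, b, a), (hA _).mpr ⟨by rw [← h1]; ring, ?_, h3⟩, rfl⟩
      rw [← hsw]
      exact mul_pos (by positivity) h2

theorem kappa_ratCast (x : ℚ) : kappa x = 1 / (x.den : ℝ) ^ 2 := by
  have h : ∃ r : ℚ, (r : ℝ) = x := ⟨x, rfl⟩
  rw [kappa, dif_pos h, Rat.cast_injective h.choose_spec]

/-- If x = r/s in lowest terms, the reciprocal has denominator |r|, and x²/r² = 1/s². The κ-term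
thus drops out of the inversion formula for k = 2. -/
theorem kappa_inv {x : ℚ} (hx : x ≠ 0) : (x : ℝ) ^ 2 * kappa ((x : ℝ)⁻¹) = kappa x := by
  rw [← Rat.cast_inv, kappa_ratCast, kappa_ratCast, Rat.den_inv_of_ne_zero hx]
  have h : (x : ℝ) = x.num / x.den := by exact_mod_cast (Rat.num_div_den x).symm
  have h1 : ((x.num.natAbs : ℕ) : ℝ) ^ 2 = (x.num : ℝ) ^ 2 := by
    rw [Nat.cast_natAbs, Int.cast_abs, sq_abs]
  have h2 : (x.num : ℝ) ≠ 0 := by exact_mod_cast Rat.num_ne_zero.mpr hx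
  have h3 : (x.den : ℝ) ≠ 0 := by exact_mod_cast x.den_ne_zero
  rw [h1, h]
  field_simp

/-- Reversing the coefficients (a, b, c) ↦ (c, b, a) turns the sum at 1/x into the sum over forms
with c < 0 that are positive at x, so `sum_sub_sum_eq_neg_Pstar` applies. Degenerate forms exist
only for square D, where they are absorbed by the Bernoulli terms. -/
theorem F_inv {K : ℕ} (hK : 0 < K) (D : ℕ) {x : ℚ} (hx : 0 < x) :
    F (2 * K) D x = (x : ℝ) ^ (2 * (2 * K) - 2) * F (2 * K) D ((x⁻¹ : ℚ) : ℝ) -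
      Polynomial.aeval (x : ℝ) (P (2 * K) D) := by
  have hx' : (0 : ℝ) < x := by exact_mod_cast hx
  have hexp : 2 * (2 * K - 1) = 2 * (2 * K) - 2 := by omega
  have hinj : Function.Injective fun p : ℤ × ℤ × ℤ => (p.2.2, p.2.1, p.1) := by
    rintro ⟨a, b, c⟩ ⟨a', b', c'⟩ h
    simp only [Prod.mk.injEq] at h ⊢
    tauto
  set V := (coneTriples_finite D x⁻¹).toFinset.map ⟨_, hinj⟩ with hVdef
  have hV : ∀ p, p ∈ V ↔
      p.2.1 ^ 2 - 4 * p.1 * p.2.2 = (D : ℤ) ∧ 0 < formEval p x ∧ p.2.2 < 0 := by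
    intro p
    have hsw := formEval_swap p hx'.ne'
    have hpos : 0 < formEval p x ↔ 0 < formEval (p.2.2, p.2.1, p.1) ((x⁻¹ : ℚ) : ℝ) := by
      rw [← hsw, Rat.cast_inv]
      exact mul_pos_iff_of_pos_left (by positivity)
    rw [hVdef, Finset.mem_map, hpos]
    constructor
    · rintro ⟨q, hq, rfl⟩
      rw [mem_coneTriples_toFinset] at hq
      exact ⟨by rw [← hq.1]; simp only [Function.Embedding.coeFn_mk]; ring, hq.2⟩
    · intro h
      refine ⟨(p.2.2, p.2.1, p.1), mem_coneTriples_toFinset.mpr ⟨?_, h.2⟩, rfl⟩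
      rw [← h.1]
      ring
  have hA := fun p => mem_coneTriples_toFinset (D := D) (x := x) (p := p)
  have hFV : (x : ℝ) ^ (2 * (2 * K) - 2) * Fstar (2 * K) D ((x⁻¹ : ℚ) : ℝ) =
      ∑ p ∈ V, formEval p x ^ (2 * K - 1) := by
    rw [Fstar_eq_sum, hVdef, Finset.sum_map, Finset.mul_sum]
    refine Finset.sum_congr rfl fun p _ => ?_
    rw [Function.Embedding.coeFn_mk, ← formEval_swap _ hx'.ne', mul_pow, ← pow_mul, hexp,
      Rat.cast_inv]
  have hkey := sum_sub_sum_eq_neg_Pstar (n := 2 * K - 1) ⟨K - 1, by omega⟩ (x : ℝ) hA hV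
  rw [← hFV, ← Fstar_eq_sum, ← aeval_Pstar_eq_sum] at hkey
  rcases eq_or_ne D 0 with rfl | h0
  · simp [F, P]
    ring
  by_cases hsq : IsSquare D
  · obtain ⟨m, rfl⟩ := id hsq
    rw [F, F, P, if_neg h0, if_neg h0, if_neg h0, if_pos hsq, if_pos hsq, if_pos hsq, Nat.sqrt_eq]
    have hn : 2 * K - 1 ≠ 0 := by omega
    rw [← pow_two] at hA hV hkey ⊢
    rw [sum_filter_fst_eq_zero hn hx' hV, sum_filter_snd_snd_eq_zero hn hx' hA, hexp] at hkey
    have hk0 : ((2 * K : ℕ) : ℝ) ≠ 0 := by exact_mod_cast (by omega : 2 * K ≠ 0)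
    rw [bernoulliBar_eq (show 0 ≤ (m : ℝ) * x by positivity),
      bernoulliBar_eq (show 0 ≤ (m : ℝ) * (x⁻¹ : ℚ) by rw [Rat.cast_inv]; positivity), map_add,
      map_mul, map_sub, Polynomial.aeval_comp, aeval_bernoulliInv (by omega) m hx'.ne']
    have hκ : ∀ t : ℝ, (if 2 * K = 2 then t * kappa x / 2 else 0) =
        (x : ℝ) ^ (2 * (2 * K) - 2) * if 2 * K = 2 then t * kappa ((x⁻¹ : ℚ) : ℝ) / 2 else 0 := by
      intro t
      split_ifs with h
      · rw [h, ← kappa_inv hx.ne', Rat.cast_inv]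
        ring
      · simp
    rw [hκ]
    simp only [map_mul, Polynomial.aeval_C, Polynomial.aeval_X, map_div₀, map_one, map_natCast,
      Rat.cast_inv, ← div_eq_mul_inv] at hkey ⊢
    have hc : ∀ a b : ℝ, 1 / ((2 * K : ℕ) : ℝ) * (a - (2 * K : ℕ) * b) =
        1 / ((2 * K : ℕ) : ℝ) * a - b := fun a b => by field_simp
    rw [hc, hc]
    linear_combination hkey
  · rw [F, F, P, if_neg h0, if_neg h0, if_neg h0, if_neg hsq, if_neg hsq, if_neg hsq]
    have h1 : (coneTriples_finite D x).toFinset.filter (fun p => p.2.2 = 0) = ∅ := by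
      refine Finset.filter_eq_empty_iff.mpr fun p hp h => hsq ?_
      have h2 := ((hA p).mp hp).1
      rw [h, mul_zero, sub_zero, pow_two] at h2
      exact Int.isSquare_natCast_iff.mp ⟨_, h2.symm⟩
    have h2 : V.filter (fun p => p.1 = 0) = ∅ := by
      refine Finset.filter_eq_empty_iff.mpr fun p hp h => hsq ?_
      have h2 := ((hV p).mp hp).1
      rw [h, mul_zero, zero_mul, sub_zero, pow_two] at h2
      exact Int.isSquare_natCast_iff.mp ⟨_, h2.symm⟩
    rw [h1, h2, Finset.sum_empty] at hkey
    linarith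

/-- At 0 the value of a form is c, so negation matches a < 0 < c with a > 0 > c. For k = 2 the
polynomial x²B₂(m/x) has the value m² at 0, which is what the κ-term compensates. -/
theorem F_zero {k : ℕ} (hk : 0 < k) (hk2 : Even k) (D : ℕ) :
    F k D 0 = -Polynomial.aeval (0 : ℝ) (P k D) := by
  have hstar : Fstar k D 0 = -Polynomial.aeval (0 : ℝ) (Pstar k D) := by
    suffices h : ∀ x : ℚ, x = 0 → Fstar k D x = -Polynomial.aeval (x : ℝ) (Pstar k D) by
      simpa using h 0 rfl
    intro x hx
    rw [Fstar_eq_sum, aeval_Pstar_eq_sum, ← Finset.sum_neg_distrib]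
    have hf : ∀ p, formEval p x = p.2.2 := fun p => by simp [formEval, hx]
    refine Finset.sum_nbij' (fun p => -p) (fun p => -p) ?_ ?_ ?_ ?_ ?_
    · intro p
      rw [mem_coneTriples_toFinset, mem_indefTriples_toFinset, hf, Int.cast_pos]
      rintro ⟨h1, h2, h3⟩
      simp only [Prod.fst_neg, Prod.snd_neg]
      exact ⟨by rw [← h1]; ring, by omega, by omega⟩
    · intro p
      rw [mem_coneTriples_toFinset, mem_indefTriples_toFinset, hf, Int.cast_pos]
      rintro ⟨h1, h2, h3⟩
      simp only [Prod.fst_neg, Prod.snd_neg]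
      exact ⟨by rw [← h1]; ring, by omega, by omega⟩
    · intro p _; simp
    · intro p _; simp
    · intro p _
      have hodd : Odd (k - 1) := Nat.Even.sub_odd hk hk2 odd_one
      rw [hf, hf, Prod.snd_neg, Prod.snd_neg, Int.cast_neg, hodd.neg_pow, neg_neg]
  have hk1 : 2 * k - 2 ≠ 0 := by
    obtain ⟨K, rfl⟩ := hk2.two_dvd
    omega
  have hinv : ∀ m : ℕ, Polynomial.aeval (0 : ℝ) (bernoulliInv k m) =
      if k = 2 then (m : ℝ) ^ 2 else 0 := by
    intro m
    rw [bernoulliInv, map_sum]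
    split_ifs with h
    · subst h
      rw [Finset.sum_range_succ, Finset.sum_eq_zero]
      · simp [Polynomial.coeff_bernoulli]
      · intro j hj
        have := Finset.mem_range.mp hj
        simp [show 2 * 2 - 2 - j ≠ 0 by omega]
    · refine Finset.sum_eq_zero fun j hj => ?_
      have := Finset.mem_range.mp hj
      obtain ⟨K, rfl⟩ := hk2.two_dvd
      simp [show 2 * (2 * K) - 2 - j ≠ 0 by omega]
  unfold F P
  split_ifs with h0 hsq hk
  · simp [hk1]; ring
  · have hκ : kappa 0 = 1 := by simpa using kappa_ratCast 0
    rw [hstar, map_add, map_mul, map_sub, hinv, if_pos hk, hκ, Polynomial.aeval_comp, bernoulliBar, hk]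
    simp
    ring
  · rw [hstar, map_add, map_mul, map_sub, hinv, if_neg hk, Polynomial.aeval_comp, bernoulliBar]
    simp
    ring
  · exact hstar

/-! ### Periodicity of F_{k,D} and descent on the denominator -/

theorem formEval_add_one (a b c : ℤ) (x : ℝ) :
    formEval (a, b, c) (x + 1) = formEval (a, 2 * a + b, a + b + c) x := by
  simp only [formEval]
  push_cast
  ring

theorem Fstar_add_one (k D : ℕ) (x : ℝ) : Fstar k D (x + 1) = Fstar k D x := by
  let e : ℤ × ℤ × ℤ ≃ ℤ × ℤ × ℤ :=
    { toFun := fun p => (p.1, 2 * p.1 + p.2.1, p.1 + p.2.1 + p.2.2)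
      invFun := fun p => (p.1, p.2.1 - 2 * p.1, p.2.2 - p.2.1 + p.1)
      left_inv := fun p => by ext <;> simp; ring
      right_inv := fun p => by ext <;> simp; ring }
  have he : ∀ p, formEval (e p) x = formEval p (x + 1) := fun p => (formEval_add_one _ _ _ x).symm
  have hmem : ∀ p, p ∈ coneTriples D (x + 1) ↔ e p ∈ coneTriples D x := fun p => by
    have h1 : (e p).2.1 ^ 2 - 4 * (e p).1 * (e p).2.2 = p.2.1 ^ 2 - 4 * p.1 * p.2.2 := by
      simp only [e, Equiv.coe_fn_mk]
      ring
    change (_ ∧ 0 < formEval p (x + 1) ∧ _) ↔ (_ ∧ 0 < formEval (e p) x ∧ _)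
    rw [h1, he]
    rfl
  rw [Fstar, Fstar, ← (e.subtypeEquiv hmem).tsum_eq]
  exact tsum_congr fun p => congrArg (· ^ (k - 1)) (he p).symm

theorem bernoulliBar_add_natCast (k m : ℕ) (x : ℝ) : bernoulliBar k (x + m) = bernoulliBar k x := by
  rw [bernoulliBar, bernoulliBar, Int.floor_add_natCast]
  push_cast
  rw [add_sub_add_right_eq_sub]

theorem F_add_one (k D : ℕ) (x : ℚ) : F k D ((x + 1 : ℚ) : ℝ) = F k D x := by
  have hκ : kappa ((x + 1 : ℚ) : ℝ) = kappa x := by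
    rw [kappa_ratCast, kappa_ratCast]
    have := Rat.add_natCast_den x 1
    rw [Nat.cast_one] at this
    rw [this]
  unfold F
  rw [hκ]
  push_cast
  rw [Fstar_add_one, mul_add, mul_one, bernoulliBar_add_natCast]

theorem F_add_intCast (k D : ℕ) (x : ℚ) (n : ℤ) : F k D ((x + n : ℚ) : ℝ) = F k D x := by
  induction n with
  | zero => simp
  | succ n ih =>
    rw [← ih, ← F_add_one k D (x + (n : ℤ))]
    push_cast
    rw [add_assoc]
  | pred n ih =>
    rw [← ih, ← F_add_one k D (x + (-(n : ℤ) - 1 : ℤ))]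
    congr 2
    push_cast
    ring

/-- Euclidean algorithm: translate x into [0, 1), then invert. Each inversion adds a multiple of the
coefficients of some S_y and lowers the denominator, until x = 0 is reached. -/
theorem modularCoeff_F {k : ℕ} (hk : 0 < k) (hk2 : Even k) (x : ℚ) :
    ModularCoeff k fun D => F k D x := by
  obtain ⟨d, hd⟩ : ∃ d, x.den = d := ⟨_, rfl⟩
  induction d using Nat.strong_induction_on generalizing x with
  | _ d ih =>
    have hfloor : ∀ D, F k D x = F k D ((Int.fract x : ℚ) : ℝ) := fun D => by
      rw [← F_add_intCast k D (Int.fract x) ⌊x⌋, Int.fract_add_floor]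
    simp_rw [hfloor]
    have hden : (Int.fract x).den = d := by rw [Int.fract, Rat.sub_intCast_den, hd]
    have h0 := Int.fract_nonneg x
    have h1 := Int.fract_lt_one x
    generalize Int.fract x = y at hden h0 h1
    rcases h0.eq_or_lt with rfl | hy
    · simp_rw [Rat.cast_zero, F_zero hk hk2]
      simpa using (modularCoeff_aeval_P hk hk2 0).smul (-1)
    · have hlt : (y⁻¹).den < d := by
        rw [Rat.den_inv_of_ne_zero hy.ne', ← hden]
        have := Rat.num_lt_denom_iff.mpr h1
        have := Rat.num_pos.mpr hy
        omega
      have h2 := ((ih _ hlt y⁻¹ rfl).smul ((y : ℝ) ^ (2 * k - 2))).add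
        ((modularCoeff_aeval_P hk hk2 (y : ℝ)).smul (-1))
      obtain ⟨K, rfl⟩ := hk2.two_dvd
      simp_rw [F_inv (show 0 < K by omega) _ hy]
      simpa [sub_eq_add_neg] using h2

end ZagierSeries

end

theorem theorem4p5 (k : ℕ) (hk : 0 < k) (hkeven : Even k) :
    (∀ x : ℝ, (∀ τ : UpperHalfPlane, Summable (ZagierSeries.STerm k x τ)) ∧
      ZagierSeries.IsModularFormHalf k (ZagierSeries.S k x)) ∧
    (∀ x : ℚ, (∀ τ : UpperHalfPlane, Summable (ZagierSeries.TTerm k (x : ℝ) τ)) ∧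
      ZagierSeries.IsModularFormHalf k (ZagierSeries.T k (x : ℝ))) := by
  refine ⟨fun x => ?_, fun x => ?_⟩
  · have h := ZagierSeries.modularCoeff_aeval_P hk hkeven x
    exact ⟨fun τ => h.1.summable τ.im_pos, h.isModularFormHalf⟩
  · have h := ZagierSeries.modularCoeff_F hk hkeven x
    exact ⟨fun τ => h.1.summable τ.im_pos, h.isModularFormHalf⟩
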